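/- Let $0<\alpha<1$, $0\le X<1$ and $m>2-\alpha$ be real numbers. For $0\le u\le z\le 1$ put $$K(z,u)=\frac{m+1}{m}\,\frac{1}{\Gamma(1-\alpha)}\int_{\left(\frac{1-z}{1-u}\right)^{\alpha/2}}^{1}\Big(s^{2/\alpha}(1-u)-\big(1-\tfrac{\alpha}{2}\big)(1-z)\Big)s^{2/\alpha}(1-s)^{-\alpha}\,ds$$ (with $K(1,1)=0$), and let $y$ be the nontrivial solution of $$y(z)^{m+1}=\int_0^z K(z,u)\,y(u)\,du,\qquad 0\le z\le 1,$$ that is, the solution that is continuous on $[0,1]$ and positive on $(0,1]$. For $N\ge 1$ let $h=1/N$, $z_n=n/N$, $K_{n,i}=K(z_n,z_i)$, and let $y_0,\dots,y_N\ge 0$ be given by the midpoint scheme: $y_0=0$, $y_1=\kappa\,h^{(2-\alpha)/m}$ and $$y_{2n+k}^{m+1}=\tfrac12 h\,K_{2n+k,k}\,y_k+2h\sum_{i=1}^{n}K_{2n+k,2i+k-1}\,y_{2i+k-1},\qquad k\in\{0,1\},\ n\ge 1,\ 2n+k\le N,$$ where $\kappa>0$ is a constant independent of $h$ (in particular, $\kappa$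 may be the coefficient in the asymptotics $y(z)\sim\kappa z^{(2-\alpha)/m}$, $z\to0^+$). Put $$D=\frac{m+1}{2m}\,\frac{1}{\Gamma(2-\alpha)}\Big(\frac{1}{1-X}\Big)^{1-\alpha},\qquad A=\frac{2D}{(m+1)\,C_1^m},$$ $$C_1=\begin{cases}\left(\left(\frac{\alpha}{2}\right)^{1-\alpha}\dfrac{\Gamma\left(\frac{2-\alpha}{m}\right)}{\Gamma\left(2-\alpha+\frac{2-\alpha}{m}\right)}\,\dfrac{1}{2-\alpha+m(3-\alpha)}\right)^{\frac1{m+1}}, & \alpha\le 1-\frac{1}{m+1},\\[3ex]\left(\left(\frac{\alpha}{2}\right)^{2-\alpha}\dfrac{\Gamma\left(1+\frac{2-\alpha}{m}\right)}{\Gamma\left(2-\alpha+\frac{2-\alpha}{m}\right)}\,\dfrac{1}{2-\alpha}\right)^{\frac1{m+1}}, & \alpha> 1-\frac{1}{m+1}.\end{cases}$$ Suppose that $$A<\alpha+\frac{2-\alpha}{m}.$$ Then the scheme converges on $[0,X]$: $$\max_{n:\ z_n\le X}|y_n-y(z_n)|\to 0\qquad\text{as } h\to 0^+,$$ and its order of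 convergence is at least $$\omega:=2-(2-\alpha)\Big(1-\frac1m\Big)-A>0,$$ in the following sense. For every $\varepsilon>0$ there is a constant $C$, independent of $N$ and $n$, such that $|y_n-y(z_n)|\le C\,h^{\omega}$ for all $N\ge1$ and all $n$ with $\varepsilon\le z_n\le X$. If moreover $\omega\le\frac{2-\alpha}{m}$, there is a constant $C$ such that $|y_n-y(z_n)|\le C\,h^\omega$ for all $N\ge 1$ and all $n$ with $0\le z_n\le X$. -/

import Mathlib

open Set

namespace PorousMedium

noncomputable section

/-- The kernel `K(z,u)`, `0 ≤ u ≤ z ≤ 1`, of the Volterra equation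
`y(z)^(m+1) = ∫_0^z K(z,u) y(u) du`. -/
def kernel (α m z u : ℝ) : ℝ :=
  (m + 1) / m * (1 / Real.Gamma (1 - α)) *
    ∫ s in ((1 - z) / (1 - u)) ^ (α / 2)..1,
      (s ^ (2 / α) * (1 - u) - (1 - α / 2) * (1 - z)) * s ^ (2 / α) * (1 - s) ^ (-α)

/-- `y` is the nontrivial solution on `[0,1]` of `y(z)^(m+1) = ∫_0^z K(z,u) y(u) du`:
continuous, nonnegative, and positive away from the origin. (The equation also has the zero
solution and solutions which vanish on an initial interval.) -/
structure IsNontrivialSolution (α m : ℝ) (y : ℝ → ℝ) : Prop where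
  continuousOn : ContinuousOn y (Icc 0 1)
  nonneg : ∀ z ∈ Icc (0 : ℝ) 1, 0 ≤ y z
  pos : ∀ z ∈ Ioc (0 : ℝ) 1, 0 < y z
  eqn : ∀ z ∈ Icc (0 : ℝ) 1, y z ^ (m + 1) = ∫ u in (0 : ℝ)..z, kernel α m z u * y u

/-- The step `h = 1 / N`. -/
def step (N : ℕ) : ℝ := 1 / (N : ℝ)

/-- The grid point `z_n = n / N`. -/
def node (N n : ℕ) : ℝ := (n : ℝ) / (N : ℝ)

/-- `Y 0, …, Y N` are the values produced on the grid with step `h = 1 / N` by the midpoint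
scheme with starting value `Y 1 = κ h^((2-α)/m)`. The field `recurrence` computes `Y n`, `2 ≤ n ≤ N`,
from the previous values: for even `n` (`k = 0`) by the midpoint rule with cells of length `2h`,
for odd `n` (`k = 1`) by the trapezoidal rule on `[0,h]` and the midpoint rule on the rest. -/
structure IsMidpointApprox (α m κ : ℝ) (N : ℕ) (Y : ℕ → ℝ) : Prop where
  zero : Y 0 = 0
  start : Y 1 = κ * step N ^ ((2 - α) / m)
  nonneg : ∀ n ≤ N, 0 ≤ Y n
  recurrence : ∀ n k : ℕ, 1 ≤ n → k ≤ 1 → 2 * n + k ≤ N →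
    Y (2 * n + k) ^ (m + 1) =
      1 / 2 * step N * kernel α m (node N (2 * n + k)) (node N k) * Y k +
      2 * step N * ∑ i ∈ Finset.Icc 1 n,
        kernel α m (node N (2 * n + k)) (node N (2 * i + k - 1)) * Y (2 * i + k - 1)

/-- The constant `C₁`. -/
def constC1 (α m : ℝ) : ℝ :=
  if α ≤ 1 - 1 / (m + 1) then
    ((α / 2) ^ (1 - α) *
      (Real.Gamma ((2 - α) / m) / Real.Gamma (2 - α + (2 - α) / m)) *
      (1 / (2 - α + m * (3 - α)))) ^ (1 / (m + 1))
  else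
    ((α / 2) ^ (2 - α) *
      (Real.Gamma (1 + (2 - α) / m) / Real.Gamma (2 - α + (2 - α) / m)) *
      (1 / (2 - α))) ^ (1 / (m + 1))

/-- The constant `D`. -/
def constD (α m X : ℝ) : ℝ :=
  (m + 1) / (2 * m) * (1 / Real.Gamma (2 - α)) * (1 / (1 - X)) ^ (1 - α)

/-- The constant `A = 2 D / ((m+1) C₁^m)`. -/
def constA (α m X : ℝ) : ℝ :=
  2 * constD α m X / ((m + 1) * constC1 α m ^ m)

/-- The order of convergence `2 - (2-α)(1-1/m) - A`. -/
def order (α m X : ℝ) : ℝ :=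
  2 - (2 - α) * (1 - 1 / m) - constA α m X

end

end PorousMedium

/-! The order `ω` in the statement is always below `1` (`order_lt_one`), so first-order consistency
suffices, and that follows from monotonicity alone: `K(z,·)` decreases and `y` increases. What has
to be proved is stability near the origin, where `y` behaves like `z^g` with `g = (2-α)/m`.

Errors are measured relatively. With `a_n = y(z_n)` and `W` the weights of the scheme, the ratio
`x_n = Y_n / a_n` satisfies `x_n^(m+1) ≤ (1 + O(1/n)) ∑ p_{n,i} x_i`, where `p_{n,i} = W_{n,i} a_i /
a_n^(m+1)` has total mass `1 + O(1/n)` (`exists_consistency`). By Cauchy–Schwarz `a_n / Y_n`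
satisfies an inequality of the same form. By Bernoulli the power on the left gains a factor `m+1`,
so `x_n ≤ 1 + M w_n` propagates for every sequence `w_n ≥ 1/n` which `p` amplifies by less than
`m+1` (`exists_le_one_add_mul`, `exists_abs_sub_le`).

For `w_n = n^(-q)` the amplification near the origin is `betaInt α (g-q) / betaInt α g`. At `q = 1`
this ratio equals exactly `1 + (2-α)/g = m+1` (`betaInt_sub_one`), so it is smaller for every `q <
1`. The limit is this clean because the upper and lower constants for the kernel, and hence for
`y(z) z^(-g)`, merge at `z = 0`. Away from the origin the amplification is merely bounded, and an
added constant `V N^(-q)` absorbs it, since constants are amplified only by about `1 < m+1`.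

The relative error is therefore `O(n^(-q))` for every `g ≤ q < 1`, that is, an absolute error `O(h^q
z_n^(g-q))`. Taking `q = max ω g` gives all the claims; the bound assumed on `A` says precisely that
`ω > 0`. -/

namespace PorousMedium

/-! ### Monotonicity and two-sided bounds for the kernel -/

lemma intervalIntegrable_one_sub_rpow {α : ℝ} (hα1 : α < 1) (a b : ℝ) :
    IntervalIntegrable (fun s : ℝ => (1 - s) ^ (-α)) MeasureTheory.volume a b := by
  have h := (intervalIntegral.intervalIntegrable_rpow' (a := 1 - a) (b := 1 - b)
    (r := -α) (by linarith)).comp_sub_left 1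
  simpa using h

lemma intervalIntegrable_kernel_integrand {α : ℝ} (hα0 : 0 < α) (hα1 : α < 1) (v p a b : ℝ) :
    IntervalIntegrable (fun s : ℝ =>
      (s ^ (2 / α) * v - (1 - α / 2) * p) * s ^ (2 / α) * (1 - s) ^ (-α))
      MeasureTheory.volume a b := by
  have hc : Continuous fun s : ℝ => s ^ (2 / α) :=
    Real.continuous_rpow_const (by positivity)
  exact (intervalIntegrable_one_sub_rpow hα1 a b).continuousOn_mul (by fun_prop)

lemma integral_one_sub_rpow {α : ℝ} (hα1 : α < 1) {a : ℝ} :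
    ∫ s in a..1, (1 - s) ^ (-α) = (1 - a) ^ (1 - α) / (1 - α) := by
  rw [intervalIntegral.integral_comp_sub_left (fun x : ℝ => x ^ (-α)) 1,
    integral_rpow (Or.inl (by linarith))]
  rw [sub_self, Real.zero_rpow (by linarith)]
  ring_nf

/-- On the range of integration of the kernel, with `r = (1-z)/(1-u)`, this makes the bracket in the
integrand at least `(α/2)(1-z)`. -/
lemma le_rpow_two_div {α r s : ℝ} (hα0 : 0 < α) (hr : 0 ≤ r) (hs : r ^ (α / 2) ≤ s) :
    r ≤ s ^ (2 / α) := by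
  have h := Real.rpow_le_rpow (Real.rpow_nonneg hr _) hs (by positivity : 0 ≤ 2 / α)
  rwa [← Real.rpow_mul hr, show α / 2 * (2 / α) = 1 by field_simp, Real.rpow_one] at h

/-- The constant in front of the integral in the kernel. -/
noncomputable def kernelFactor (α m : ℝ) : ℝ := (m + 1) / m * (1 / Real.Gamma (1 - α))

/-- The constant in `K(z,u) ∼ c (z-u)^(1-α)` near the origin. -/
noncomputable def kernelConst (α m : ℝ) : ℝ :=
  kernelFactor α m / (1 - α) * (α / 2) ^ (2 - α)

lemma kernelFactor_pos {α m : ℝ} (hα1 : α < 1) (hm : 0 < m) : 0 < kernelFactor α m := by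
  have := Real.Gamma_pos_of_pos (show 0 < 1 - α by linarith)
  unfold kernelFactor; positivity

lemma kernelConst_pos {α m : ℝ} (hα0 : 0 < α) (hα1 : α < 1) (hm : 0 < m) :
    0 < kernelConst α m := by
  have := kernelFactor_pos hα1 hm
  have : 0 < 1 - α := by linarith
  unfold kernelConst; positivity

/-- The kernel increases in `z` and decreases in `u`. -/
lemma kernel_le_kernel {α m z z' u u' : ℝ} (hα0 : 0 < α) (hα1 : α < 1) (hm : 0 < m)
    (hu : u' ≤ u) (huz : u ≤ z) (hz : z ≤ z') (hz1 : z' < 1) :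
    kernel α m z u ≤ kernel α m z' u' := by
  unfold kernel
  refine mul_le_mul_of_nonneg_left ?_ (kernelFactor_pos hα1 hm).le
  have hp : 0 < 1 - z' := by linarith
  have hp2 : 0 < 1 - z := by linarith
  have hv : 0 < 1 - u := by linarith
  have hv2 : 0 < 1 - u' := by linarith
  set a := ((1 - z) / (1 - u)) ^ (α / 2) with ha
  set a' := ((1 - z') / (1 - u')) ^ (α / 2) with ha'
  have haa : a' ≤ a := by
    apply Real.rpow_le_rpow (by positivity) _ (by positivity)
    gcongr
  have ha1 : a ≤ 1 := Real.rpow_le_one (by positivity) ((div_le_one hv).2 (by linarith))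
    (by positivity)
  have ha0 : 0 ≤ a' := by positivity
  have hint := intervalIntegrable_kernel_integrand hα0 hα1
  -- Two effects push the same way: a smaller lower limit adds a nonnegative piece, and on the
  -- common range the integrand grows pointwise.
  rw [← intervalIntegral.integral_add_adjacent_intervals (hint (1 - u') (1 - z') a' a)
    (hint (1 - u') (1 - z') a 1)]
  have hnn : 0 ≤ ∫ s in a'..a, (s ^ (2 / α) * (1 - u') - (1 - α / 2) * (1 - z')) *
      s ^ (2 / α) * (1 - s) ^ (-α) := by
    refine intervalIntegral.integral_nonneg haa fun s hs => ?_
    have h1 := le_rpow_two_div hα0 (by positivity) hs.1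
    rw [div_le_iff₀ hv2] at h1
    have hs0 : 0 ≤ s := ha0.trans hs.1
    have hs1 : 0 ≤ 1 - s := by linarith [hs.2]
    have : 0 ≤ s ^ (2 / α) * (1 - u') - (1 - α / 2) * (1 - z') := by nlinarith
    positivity
  have hle : ∫ s in a..1, (s ^ (2 / α) * (1 - u) - (1 - α / 2) * (1 - z)) *
      s ^ (2 / α) * (1 - s) ^ (-α) ≤
      ∫ s in a..1, (s ^ (2 / α) * (1 - u') - (1 - α / 2) * (1 - z')) *
      s ^ (2 / α) * (1 - s) ^ (-α) := by
    refine intervalIntegral.integral_mono_on ha1 (hint _ _ _ _) (hint _ _ _ _) fun s hs => ?_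
    have hs0 : 0 ≤ s := (ha0.trans haa).trans hs.1
    have hs1 : 0 ≤ 1 - s := by linarith [hs.2]
    have h2 : 0 ≤ s ^ (2 / α) := by positivity
    gcongr
    linarith
  linarith

/-- Bernoulli's inequality for an exponent in `(0,1]`, applied to `p/v` for the lower bound and to
`v/p` for the upper one. It makes the length of the range of integration in the kernel comparable to
`z-u`. -/
lemma one_sub_rpow_bounds {a p v : ℝ} (ha0 : 0 < a) (ha1 : a ≤ 1) (hp : 0 < p) (hpv : p ≤ v) :
    a * ((v - p) / v) ≤ 1 - (p / v) ^ a ∧ 1 - (p / v) ^ a ≤ a * ((v - p) / p) := by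
  have hv : 0 < v := hp.trans_le hpv
  constructor
  · have h := rpow_one_add_le_one_add_mul_self (s := p / v - 1) (p := a)
      (by have : 0 < p / v := by positivity
          linarith) ha0.le ha1
    have e : (v - p) / v = 1 - p / v := by field_simp
    rw [e]
    rw [add_sub_cancel] at h
    linarith
  · have h := rpow_one_add_le_one_add_mul_self (s := v / p - 1) (p := a)
      (by have : 0 < v / p := by positivity
          linarith) ha0.le ha1
    rw [add_sub_cancel] at h
    have e : (v - p) / p = v / p - 1 := by field_simp
    have h1 : (p / v) ^ a * (v / p) ^ a = 1 := by
      rw [← Real.mul_rpow (by positivity) (by positivity),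
        show p / v * (v / p) = 1 by field_simp, Real.one_rpow]
    have h2 : (p / v) ^ a ≤ 1 :=
      Real.rpow_le_one (by positivity) ((div_le_one hv).2 hpv) ha0.le
    have h3 : 0 < (p / v) ^ a := by positivity
    have h4 : 0 ≤ v / p - 1 := by rw [← e]; apply div_nonneg <;> linarith
    rw [e]
    have : (p / v) ^ a * (v / p) ^ a ≤ (p / v) ^ a * (1 + a * (v / p - 1)) := by gcongr
    nlinarith [mul_nonneg ha0.le h4]

/-- The bracket is at least `(α/2)(1-z)` and `s^(2/α) ≥ 1-z`, and the singular factor integrates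
exactly. The factor `(1-z)^2` tends to `1` at the origin, so the constant there is the sharp one, as
in `kernel_le`; the contraction near `0` depends on this agreement. -/
lemma le_kernel {α m z u : ℝ} (hα0 : 0 < α) (hα1 : α < 1) (hm : 0 < m)
    (hu : 0 ≤ u) (huz : u ≤ z) (hz1 : z < 1) :
    kernelConst α m * (1 - z) ^ 2 * (z - u) ^ (1 - α) ≤ kernel α m z u := by
  have hk := kernelFactor_pos hα1 hm
  have hp : 0 < 1 - z := by linarith
  have hv : 0 < 1 - u := by linarith
  have hβ : 0 < 1 - α := by linarith
  obtain ⟨hb1, -⟩ := one_sub_rpow_bounds (a := α / 2) (by positivity) (by linarith) hp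
    (show 1 - z ≤ 1 - u by linarith)
  set a := ((1 - z) / (1 - u)) ^ (α / 2) with ha
  have ha1 : a ≤ 1 := Real.rpow_le_one (by positivity) ((div_le_one hv).2 (by linarith))
    (by positivity)
  have ha0 : 0 ≤ a := by positivity
  have hzu : 0 ≤ z - u := by linarith
  have hlow : α / 2 * (z - u) ≤ 1 - a := by
    refine le_trans ?_ hb1
    gcongr
    rw [le_div_iff₀ hv]; nlinarith
  have hmain : α / 2 * (1 - z) ^ 2 * ((1 - a) ^ (1 - α) / (1 - α)) ≤
      ∫ s in a..1, (s ^ (2 / α) * (1 - u) - (1 - α / 2) * (1 - z)) *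
      s ^ (2 / α) * (1 - s) ^ (-α) := by
    rw [← integral_one_sub_rpow hα1, ← intervalIntegral.integral_const_mul]
    refine intervalIntegral.integral_mono_on ha1
      ((intervalIntegrable_one_sub_rpow hα1 _ _).const_mul _)
      (intervalIntegrable_kernel_integrand hα0 hα1 _ _ _ _) fun s hs => ?_
    have hs1 : 0 ≤ 1 - s := by linarith [hs.2]
    refine mul_le_mul_of_nonneg_right ?_ (by positivity)
    have h1 := le_rpow_two_div hα0 (by positivity) hs.1
    have h2 : 1 - z ≤ s ^ (2 / α) := by
      refine le_trans ?_ h1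
      rw [le_div_iff₀ hv]; nlinarith
    rw [div_le_iff₀ hv] at h1
    have h3 : α / 2 * (1 - z) ≤ s ^ (2 / α) * (1 - u) - (1 - α / 2) * (1 - z) := by nlinarith
    calc α / 2 * (1 - z) ^ 2 = (α / 2 * (1 - z)) * (1 - z) := by ring
      _ ≤ _ := mul_le_mul h3 h2 hp.le (le_trans (by positivity) h3)
  have hpow : (α / 2) ^ (2 - α) = (α / 2) * (α / 2) ^ (1 - α) := by
    rw [show 2 - α = 1 + (1 - α) by ring, Real.rpow_add (by positivity), Real.rpow_one]
  calc kernelConst α m * (1 - z) ^ 2 * (z - u) ^ (1 - α)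
      = kernelFactor α m * (α / 2 * (1 - z) ^ 2 * ((α / 2 * (z - u)) ^ (1 - α) / (1 - α))) := by
        rw [Real.mul_rpow (by positivity) hzu, kernelConst, hpow]; ring
    _ ≤ kernelFactor α m * (α / 2 * (1 - z) ^ 2 * ((1 - a) ^ (1 - α) / (1 - α))) := by gcongr
    _ ≤ _ := mul_le_mul_of_nonneg_left hmain hk.le

/-- Here the bracket is at most `1 - (1-α/2)(1-z) ≤ α/2 + z` and `s^(2/α) ≤ 1`. -/
lemma kernel_le {α m z u : ℝ} (hα0 : 0 < α) (hα1 : α < 1) (hm : 0 < m)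
    (hu : 0 ≤ u) (huz : u ≤ z) (hz1 : z < 1) :
    kernel α m z u ≤
      kernelConst α m * ((1 + 2 / α * z) * (1 / (1 - z)) ^ (1 - α)) * (z - u) ^ (1 - α) := by
  have hk := kernelFactor_pos hα1 hm
  have hp : 0 < 1 - z := by linarith
  have hv : 0 < 1 - u := by linarith
  have hz0 : 0 ≤ z := by linarith
  have hβ : 0 < 1 - α := by linarith
  obtain ⟨-, hb1⟩ := one_sub_rpow_bounds (a := α / 2) (by positivity) (by linarith) hp
    (show 1 - z ≤ 1 - u by linarith)
  set a := ((1 - z) / (1 - u)) ^ (α / 2) with ha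
  have ha1 : a ≤ 1 := Real.rpow_le_one (by positivity) ((div_le_one hv).2 (by linarith))
    (by positivity)
  have ha0 : 0 ≤ a := by positivity
  have hzu : 0 ≤ z - u := by linarith
  have hlow : 1 - a ≤ α / 2 * ((z - u) * (1 / (1 - z))) := by
    refine hb1.trans (le_of_eq ?_)
    ring
  have hmain : (∫ s in a..1, (s ^ (2 / α) * (1 - u) - (1 - α / 2) * (1 - z)) *
      s ^ (2 / α) * (1 - s) ^ (-α)) ≤
      α / 2 * (1 + 2 / α * z) * ((1 - a) ^ (1 - α) / (1 - α)) := by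
    rw [← integral_one_sub_rpow hα1, ← intervalIntegral.integral_const_mul]
    refine intervalIntegral.integral_mono_on ha1
      (intervalIntegrable_kernel_integrand hα0 hα1 _ _ _ _)
      ((intervalIntegrable_one_sub_rpow hα1 _ _).const_mul _) fun s hs => ?_
    have hs1 : 0 ≤ 1 - s := by linarith [hs.2]
    have hs0 : 0 ≤ s := ha0.trans hs.1
    refine mul_le_mul_of_nonneg_right ?_ (by positivity)
    have h1 : s ^ (2 / α) ≤ 1 := Real.rpow_le_one hs0 hs.2 (by positivity)
    have h2 : 0 ≤ s ^ (2 / α) := by positivity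
    have h3 : s ^ (2 / α) * (1 - u) - (1 - α / 2) * (1 - z) ≤ α / 2 * (1 + 2 / α * z) := by
      have : α / 2 * (1 + 2 / α * z) = α / 2 + z := by field_simp
      rw [this]
      nlinarith
    have h4 : 0 ≤ α / 2 * (1 + 2 / α * z) := by positivity
    calc _ ≤ α / 2 * (1 + 2 / α * z) * s ^ (2 / α) := by gcongr
      _ ≤ α / 2 * (1 + 2 / α * z) * 1 := by gcongr
      _ = _ := mul_one _
  have hpow : (α / 2) ^ (2 - α) = (α / 2) * (α / 2) ^ (1 - α) := by
    rw [show 2 - α = 1 + (1 - α) by ring, Real.rpow_add (by positivity), Real.rpow_one]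
  have h1a : 0 ≤ 1 - a := by linarith
  calc kernel α m z u
      ≤ kernelFactor α m * (α / 2 * (1 + 2 / α * z) * ((1 - a) ^ (1 - α) / (1 - α))) :=
        mul_le_mul_of_nonneg_left hmain hk.le
    _ ≤ kernelFactor α m * (α / 2 * (1 + 2 / α * z) *
        ((α / 2 * ((z - u) * (1 / (1 - z)))) ^ (1 - α) / (1 - α))) := by gcongr
    _ = _ := by
        rw [Real.mul_rpow (by positivity) (by positivity), Real.mul_rpow hzu (by positivity),
          kernelConst, hpow]
        ring

lemma kernel_nonneg {α m z u : ℝ} (hα0 : 0 < α) (hα1 : α < 1) (hm : 0 < m)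
    (hu : 0 ≤ u) (huz : u ≤ z) (hz1 : z < 1) : 0 ≤ kernel α m z u := by
  refine le_trans ?_ (le_kernel hα0 hα1 hm hu huz hz1)
  have := kernelConst_pos hα0 hα1 hm
  have : 0 ≤ z - u := by linarith
  positivity

/-! ### Beta integrals and the critical exponent -/

/-- The Beta integral `∫_0^1 (1-t)^(1-α) t^s dt`. -/
noncomputable def betaInt (α s : ℝ) : ℝ := ∫ t in (0 : ℝ)..1, (1 - t) ^ (1 - α) * t ^ s

lemma intervalIntegrable_sub_rpow_mul_rpow {α s : ℝ} (hα1 : α < 1) (hs : -1 < s) (z a b : ℝ) :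
    IntervalIntegrable (fun t : ℝ => (z - t) ^ (1 - α) * t ^ s) MeasureTheory.volume a b := by
  have hc : Continuous fun t : ℝ => (z - t) ^ (1 - α) :=
    (continuous_const.sub continuous_id).rpow_const fun _ => Or.inr (by linarith)
  exact (intervalIntegral.intervalIntegrable_rpow' hs).continuousOn_mul hc.continuousOn

lemma betaInt_pos {α s : ℝ} (hα1 : α < 1) (hs : -1 < s) : 0 < betaInt α s := by
  refine intervalIntegral.intervalIntegral_pos_of_pos_on
    (intervalIntegrable_sub_rpow_mul_rpow hα1 hs 1 0 1) (fun t ht => ?_) one_pos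
  have : 0 < 1 - t := by linarith [ht.2]
  have := ht.1
  positivity

lemma integral_sub_rpow_mul_rpow {α s z : ℝ} (hz : 0 < z) :
    ∫ u in (0 : ℝ)..z, (z - u) ^ (1 - α) * u ^ s = betaInt α s * z ^ (2 - α + s) := by
  have h := intervalIntegral.integral_comp_mul_left (a := 0) (b := 1)
    (fun u : ℝ => (z - u) ^ (1 - α) * u ^ s) hz.ne'
  rw [mul_zero, mul_one, smul_eq_mul, eq_comm, inv_mul_eq_iff_eq_mul₀ hz.ne'] at h
  rw [h, betaInt, mul_comm _ (z ^ _), ← intervalIntegral.integral_const_mul,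
    ← intervalIntegral.integral_const_mul]
  refine intervalIntegral.integral_congr fun t ht => ?_
  rw [uIcc_of_le zero_le_one] at ht
  have h1 : 0 ≤ 1 - t := by linarith [ht.2]
  have h2 : z - z * t = z * (1 - t) := by ring
  have h3 : z ^ (2 - α + s) = z * (z ^ (1 - α) * z ^ s) := by
    rw [← Real.rpow_add hz, show 2 - α + s = 1 + (1 - α + s) by ring, Real.rpow_add hz,
      Real.rpow_one]
  simp only [h2, h3, Real.mul_rpow hz.le h1, Real.mul_rpow hz.le ht.1]
  ring

lemma integral_sub_rpow_mul_sub_rpow {α s δ z : ℝ} (hz : δ < z) :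
    ∫ u in δ..z, (z - u) ^ (1 - α) * (u - δ) ^ s = betaInt α s * (z - δ) ^ (2 - α + s) := by
  rw [← integral_sub_rpow_mul_rpow (sub_pos.2 hz)]
  have h := intervalIntegral.integral_comp_sub_right (a := δ) (b := z)
    (fun u : ℝ => (z - δ - u) ^ (1 - α) * u ^ s) δ
  simpa using h

/-- The function `(1-t)^(2-α) t^s` vanishes at both ends, so its derivative has integral zero. For
`s = (2-α)/m` the factor is `m+1`: the exponent `q = 1` is critical for the error recursion. -/
lemma betaInt_sub_one {α s : ℝ} (hα1 : α < 1) (hs : 0 < s) :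
    betaInt α (s - 1) = (1 + (2 - α) / s) * betaInt α s := by
  have hi1 := intervalIntegrable_sub_rpow_mul_rpow hα1 (show -1 < s - 1 by linarith) 1 0 1
  have hi2 := intervalIntegrable_sub_rpow_mul_rpow hα1 (show -1 < s by linarith) 1 0 1
  have hFTC : ∫ t in (0 : ℝ)..1, (s * ((1 - t) ^ (1 - α) * t ^ (s - 1)) -
      (s + (2 - α)) * ((1 - t) ^ (1 - α) * t ^ s)) = 0 := by
    rw [intervalIntegral.integral_eq_sub_of_hasDerivAt_of_le
      (f := fun t : ℝ => (1 - t) ^ (2 - α) * t ^ s) zero_le_one]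
    · simp [Real.zero_rpow hs.ne', Real.zero_rpow (show 2 - α ≠ 0 by linarith)]
    · have h1 : Continuous fun t : ℝ => (1 - t) ^ (2 - α) :=
        (continuous_const.sub continuous_id).rpow_const fun _ => Or.inr (by linarith)
      exact (h1.mul (Real.continuous_rpow_const hs.le)).continuousOn
    · intro t ht
      have h1 : 0 < 1 - t := by linarith [ht.2]
      have hd1 : HasDerivAt (fun t : ℝ => (1 - t) ^ (2 - α))
          ((-1) * (2 - α) * (1 - t) ^ (2 - α - 1)) t :=
        ((hasDerivAt_id t).const_sub 1).rpow_const (Or.inl h1.ne')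
      have hd2 : HasDerivAt (fun t : ℝ => t ^ s) (s * t ^ (s - 1)) t :=
        Real.hasDerivAt_rpow_const (Or.inl ht.1.ne')
      convert! hd1.mul hd2 using 1
      have e1 : (1 - t) ^ (2 - α) = (1 - t) * (1 - t) ^ (1 - α) := by
        rw [show 2 - α = 1 + (1 - α) by ring, Real.rpow_add h1, Real.rpow_one]
      have e2 : t ^ s = t * t ^ (s - 1) := by
        conv_lhs => rw [show s = 1 + (s - 1) by ring, Real.rpow_add ht.1, Real.rpow_one]
      rw [e1, e2, show 2 - α - 1 = 1 - α by ring]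
      ring
    · exact (hi1.const_mul s).sub (hi2.const_mul _)
  rw [intervalIntegral.integral_sub (hi1.const_mul s) (hi2.const_mul _),
    intervalIntegral.integral_const_mul, intervalIntegral.integral_const_mul] at hFTC
  unfold betaInt
  field_simp
  linarith

/-- Strict because `t^(s-q) < t^(s-1)` on `(0,1)`. This is the gap that makes the recursion contract
for `q < 1`. -/
lemma betaInt_sub_lt {α s q : ℝ} (hα1 : α < 1) (hs : 0 < s) (hq : q < 1) :
    betaInt α (s - q) < (1 + (2 - α) / s) * betaInt α s := by
  rw [← betaInt_sub_one hα1 hs, ← sub_pos]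
  have hi1 := intervalIntegrable_sub_rpow_mul_rpow hα1 (show -1 < s - 1 by linarith) 1 0 1
  have hi2 := intervalIntegrable_sub_rpow_mul_rpow hα1 (show -1 < s - q by linarith) 1 0 1
  unfold betaInt
  rw [← intervalIntegral.integral_sub hi1 hi2]
  refine intervalIntegral.intervalIntegral_pos_of_pos_on (hi1.sub hi2) (fun t ht => ?_) one_pos
  have h1 : 0 < 1 - t := by linarith [ht.2]
  have h2 := Real.rpow_lt_rpow_of_exponent_gt ht.1 ht.2 (show s - 1 < s - q by linarith)
  have h3 := Real.rpow_pos_of_pos h1 (1 - α)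
  have := mul_lt_mul_of_pos_left h2 h3
  linarith

/-! ### Power bounds for the nontrivial solution -/

lemma rpow_add_one' {x m : ℝ} (hx : 0 ≤ x) (hm : 0 < m) : x ^ (m + 1) = x ^ m * x := by
  rw [Real.rpow_add' hx (by linarith), Real.rpow_one]

lemma le_rpow_of_mul_le_rpow_add_one {a x m : ℝ} (hx : 0 < x) (h : a * x ≤ x ^ (m + 1)) :
    a ≤ x ^ m := by
  rw [Real.rpow_add hx, Real.rpow_one] at h
  exact le_of_mul_le_mul_right h hx

lemma rpow_le_of_rpow_add_one_le_mul {a x m : ℝ} (hx : 0 < x) (h : x ^ (m + 1) ≤ a * x) :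
    x ^ m ≤ a := by
  rw [Real.rpow_add hx, Real.rpow_one] at h
  exact le_of_mul_le_mul_right h hx

namespace IsNontrivialSolution

variable {α m : ℝ} {y : ℝ → ℝ}

lemma apply_zero (hy : IsNontrivialSolution α m y) : y 0 = 0 := by
  have h := hy.eqn 0 (by simp)
  rw [intervalIntegral.integral_same] at h
  by_contra hne
  have : 0 < y 0 := lt_of_le_of_ne (hy.nonneg 0 (by simp)) (Ne.symm hne)
  have := Real.rpow_pos_of_pos this (m + 1)
  linarith

lemma intervalIntegrable (hy : IsNontrivialSolution α m y) (hα0 : 0 < α) (hα1 : α < 1)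
    (hm : 0 < m) {a b z : ℝ} (ha : 0 ≤ a) (hab : a ≤ b) (hbz : b ≤ z) (hz1 : z < 1) :
    IntervalIntegrable (fun u => kernel α m z u * y u) MeasureTheory.volume a b := by
  have h1 : AntitoneOn (kernel α m z) (uIcc a b) := by
    rw [uIcc_of_le hab]
    intro u hu v hv huv
    exact kernel_le_kernel hα0 hα1 hm huv (hv.2.trans hbz) le_rfl hz1
  refine h1.intervalIntegrable.mul_continuousOn (hy.continuousOn.mono ?_)
  rw [uIcc_of_le hab]
  exact Icc_subset_Icc ha (by linarith)

lemma le_of_le (hy : IsNontrivialSolution α m y) (hα0 : 0 < α) (hα1 : α < 1)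
    (hm : 0 < m) {z z' : ℝ} (hz0 : 0 ≤ z) (hzz : z ≤ z') (hz1 : z' < 1) : y z ≤ y z' := by
  have hz' : 0 ≤ z' := hz0.trans hzz
  have h1 := hy.eqn z ⟨hz0, by linarith⟩
  have h2 := hy.eqn z' ⟨hz', by linarith⟩
  have hi := fun {a b w : ℝ} => hy.intervalIntegrable hα0 hα1 hm (a := a) (b := b) (z := w)
  rw [← intervalIntegral.integral_add_adjacent_intervals (hi le_rfl hz0 hzz hz1)
    (hi hz0 hzz le_rfl hz1)] at h2
  have h3 : 0 ≤ ∫ u in z..z', kernel α m z' u * y u :=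
    intervalIntegral.integral_nonneg hzz fun u hu =>
      mul_nonneg (kernel_nonneg hα0 hα1 hm (hz0.trans hu.1) hu.2 hz1)
        (hy.nonneg u ⟨hz0.trans hu.1, by linarith [hu.2]⟩)
  have h4 : ∫ u in (0 : ℝ)..z, kernel α m z u * y u ≤ ∫ u in (0 : ℝ)..z, kernel α m z' u * y u :=
    intervalIntegral.integral_mono_on hz0 (hi le_rfl hz0 le_rfl (by linarith))
      (hi le_rfl hz0 hzz hz1) fun u hu =>
      mul_le_mul_of_nonneg_right (kernel_le_kernel hα0 hα1 hm le_rfl hu.2 hzz hz1)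
        (hy.nonneg u ⟨hu.1, by linarith [hu.2]⟩)
  refine (Real.rpow_le_rpow_iff (hy.nonneg z ⟨hz0, by linarith⟩)
    (hy.nonneg z' ⟨hz', by linarith⟩) (show 0 < m + 1 by linarith)).1 ?_
  linarith

/-- The infimum `l` of `y(w)/(w-δ)^g` over `(δ,Z]` reproduces itself through the equation: `l^(m+1)
≥ b l betaInt α g`. Cancelling `l` requires `l > 0`, which is not known in advance for `δ = 0`; for
`δ > 0` monotonicity gives `y(w) ≥ y(δ) > 0`. -/
lemma shifted_lower (hy : IsNontrivialSolution α m y) (hα0 : 0 < α) (hα1 : α < 1)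
    (hm : 0 < m) {g b Z : ℝ} (hg0 : 0 < g) (hg : g * m = 2 - α) (hb : 0 < b) (hZ1 : Z < 1)
    (hK : ∀ u z, 0 ≤ u → u ≤ z → z ≤ Z → b * (z - u) ^ (1 - α) ≤ kernel α m z u)
    {δ z : ℝ} (hδ : 0 < δ) (hδz : δ < z) (hzZ : z ≤ Z) :
    b * betaInt α g * (z - δ) ^ (2 - α) ≤ y z ^ m := by
  have hJ := betaInt_pos hα1 (show -1 < g by linarith)
  have hδZ : δ < Z := hδz.trans_le hzZ
  set r : ℝ → ℝ := fun w => y w / (w - δ) ^ g with hr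
  have hlow : ∀ w ∈ Ioc δ Z, y δ / Z ^ g ≤ r w := by
    intro w hw
    have h1 : 0 < w - δ := by linarith [hw.1]
    have h2 := hy.le_of_le hα0 hα1 hm hδ.le hw.1.le (by linarith [hw.2])
    have h3 : 0 ≤ y δ := hy.nonneg δ ⟨hδ.le, by linarith⟩
    have h4 : w - δ ≤ Z := by linarith [hw.2]
    simp only [hr]
    gcongr
    linarith
  set S := r '' Ioc δ Z with hS
  have hbdd : BddBelow S := ⟨_, by rintro _ ⟨w, hw, rfl⟩; exact hlow w hw⟩
  have hne : S.Nonempty := ⟨_, z, ⟨hδz, hzZ⟩, rfl⟩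
  set l := sInf S with hl
  have hl0 : 0 < l := by
    have h1 : y δ / Z ^ g ≤ l := le_csInf hne (by rintro _ ⟨w, hw, rfl⟩; exact hlow w hw)
    have h2 : 0 < y δ := hy.pos δ ⟨hδ, by linarith⟩
    have h3 : 0 < Z ^ g := Real.rpow_pos_of_pos (by linarith) _
    exact (by positivity : 0 < y δ / Z ^ g).trans_le h1
  have hyl : ∀ w ∈ Ioc δ Z, l * (w - δ) ^ g ≤ y w := by
    intro w hw
    have h1 : 0 < w - δ := by linarith [hw.1]
    have : l ≤ r w := csInf_le hbdd ⟨w, hw, rfl⟩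
    rwa [hr, le_div_iff₀ (by positivity)] at this
  have hstep : ∀ w ∈ Ioc δ Z, b * l * betaInt α g * (w - δ) ^ (2 - α + g) ≤ y w ^ (m + 1) := by
    intro w hw
    have hw0 : 0 ≤ w := by linarith [hw.1]
    have hw1 : w < 1 := by linarith [hw.2]
    have hi := fun {a b w : ℝ} => hy.intervalIntegrable hα0 hα1 hm (a := a) (b := b) (z := w)
    rw [hy.eqn w ⟨hw0, hw1.le⟩, ← intervalIntegral.integral_add_adjacent_intervals
      (hi le_rfl hδ.le hw.1.le hw1) (hi hδ.le hw.1.le le_rfl hw1)]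
    have h1 : 0 ≤ ∫ u in (0:ℝ)..δ, kernel α m w u * y u :=
      intervalIntegral.integral_nonneg hδ.le fun u hu =>
        mul_nonneg (kernel_nonneg hα0 hα1 hm hu.1 (hu.2.trans hw.1.le) hw1)
          (hy.nonneg u ⟨hu.1, by linarith [hu.2]⟩)
    have h2 : b * l * betaInt α g * (w - δ) ^ (2 - α + g) ≤
        ∫ u in δ..w, kernel α m w u * y u := by
      rw [mul_assoc, ← integral_sub_rpow_mul_sub_rpow hw.1, ← intervalIntegral.integral_const_mul]
      have hii : IntervalIntegrable (fun u : ℝ => (w - u) ^ (1 - α) * (u - δ) ^ g)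
          MeasureTheory.volume δ w := by
        have hc1 : Continuous fun t : ℝ => (w - t) ^ (1 - α) :=
          (continuous_const.sub continuous_id).rpow_const fun _ => Or.inr (by linarith)
        have hc2 : Continuous fun t : ℝ => (t - δ) ^ g :=
          (continuous_id.sub continuous_const).rpow_const fun _ => Or.inr hg0.le
        exact (hc1.mul hc2).intervalIntegrable _ _
      refine intervalIntegral.integral_mono_on_of_le_Ioo hw.1.le (hii.const_mul _)
        (hi hδ.le hw.1.le le_rfl hw1) fun u hu => ?_
      have h3 := hK u w (by linarith [hu.1]) hu.2.le hw.2
      have h4 := hyl u ⟨hu.1, by linarith [hu.2, hw.2]⟩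
      have h5 : 0 < u - δ := by linarith [hu.1]
      have h6 : 0 < w - u := by linarith [hu.2]
      calc b * l * ((w - u) ^ (1 - α) * (u - δ) ^ g)
          = (b * (w - u) ^ (1 - α)) * (l * (u - δ) ^ g) := by ring
        _ ≤ _ := mul_le_mul h3 h4 (by positivity) (le_trans (by positivity) h3)
    linarith
  have hrl : ∀ w ∈ Ioc δ Z, (b * l * betaInt α g) ^ (m + 1)⁻¹ ≤ r w := by
    intro w hw
    have h1 : 0 < w - δ := by linarith [hw.1]
    have hyw : 0 < y w := hy.pos w ⟨by linarith [hw.1], by linarith [hw.2]⟩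
    have hrw : 0 ≤ r w := by simp only [hr]; positivity
    rw [Real.rpow_inv_le_iff_of_pos (by positivity) hrw (by linarith), hr,
      Real.div_rpow hyw.le (by positivity), ← Real.rpow_mul h1.le, le_div_iff₀ (by positivity),
      show g * (m + 1) = 2 - α + g by rw [← hg]; ring]
    exact hstep w hw
  -- The bound on `r w` is uniform in `w`, so it passes to the infimum.
  have hll : b * betaInt α g ≤ l ^ m := by
    apply le_rpow_of_mul_le_rpow_add_one hl0
    have h1 : (b * l * betaInt α g) ^ (m + 1)⁻¹ ≤ l :=
      le_csInf hne (by rintro _ ⟨w, hw, rfl⟩; exact hrl w hw)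
    rw [Real.rpow_inv_le_iff_of_pos (by positivity) hl0.le (by linarith)] at h1
    linarith
  have hzδ : 0 < z - δ := by linarith
  calc b * betaInt α g * (z - δ) ^ (2 - α) ≤ l ^ m * (z - δ) ^ (2 - α) := by gcongr
    _ = (l * (z - δ) ^ g) ^ m := by
      rw [Real.mul_rpow hl0.le (by positivity), ← Real.rpow_mul hzδ.le, hg]
    _ ≤ y z ^ m := by
      gcongr
      exact hyl z ⟨hδz, hzZ⟩

/-- The constant in `shifted_lower` does not depend on `δ`, so `δ → 0⁺` is allowed. -/
lemma lower (hy : IsNontrivialSolution α m y) (hα0 : 0 < α) (hα1 : α < 1)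
    (hm : 0 < m) {g b Z : ℝ} (hg0 : 0 < g) (hg : g * m = 2 - α) (hb : 0 < b) (hZ1 : Z < 1)
    (hK : ∀ u z, 0 ≤ u → u ≤ z → z ≤ Z → b * (z - u) ^ (1 - α) ≤ kernel α m z u)
    {z : ℝ} (hz : 0 ≤ z) (hzZ : z ≤ Z) :
    (b * betaInt α g) ^ m⁻¹ * z ^ g ≤ y z := by
  have hJ := betaInt_pos hα1 (show -1 < g by linarith)
  rcases hz.eq_or_lt with rfl | hz
  · rw [Real.zero_rpow hg0.ne', mul_zero, hy.apply_zero]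
  have hlim : b * betaInt α g * (z - 0) ^ (2 - α) ≤ y z ^ m := by
    have hc : Continuous fun δ : ℝ => b * betaInt α g * (z - δ) ^ (2 - α) :=
      continuous_const.mul
        ((continuous_const.sub continuous_id).rpow_const fun _ => Or.inr (by linarith))
    refine le_of_tendsto (hc.continuousWithinAt (s := Ioi 0)).tendsto ?_
    filter_upwards [Ioo_mem_nhdsGT hz] with δ hδ
    exact hy.shifted_lower hα0 hα1 hm hg0 hg hb hZ1 hK hδ.1 hδ.2 hzZ
  have hyz : 0 ≤ y z := hy.nonneg z ⟨hz.le, by linarith⟩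
  have h := Real.rpow_le_rpow (by positivity) hlim (show 0 ≤ m⁻¹ by positivity)
  rw [← Real.rpow_mul hyz, mul_inv_cancel₀ hm.ne', Real.rpow_one, sub_zero,
    Real.mul_rpow (by positivity) (by positivity), ← Real.rpow_mul hz.le, ← hg,
    mul_inv_cancel_right₀ hm.ne'] at h
  exact h

/-- The same self-improvement with the supremum of `y(w)/w^g`. No shift is needed, because only
finiteness of the supremum has to be known beforehand. -/
lemma upper (hy : IsNontrivialSolution α m y) (hα0 : 0 < α) (hα1 : α < 1)
    (hm : 0 < m) {g B Z : ℝ} (hg0 : 0 < g) (hg : g * m = 2 - α) (hB : 0 < B) (hZ1 : Z < 1)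
    (hK : ∀ u z, 0 ≤ u → u ≤ z → z ≤ Z → kernel α m z u ≤ B * (z - u) ^ (1 - α))
    {z : ℝ} (hz : 0 ≤ z) (hzZ : z ≤ Z) :
    y z ≤ (B * betaInt α g) ^ m⁻¹ * z ^ g := by
  have hJ := betaInt_pos hα1 (show -1 < g by linarith)
  rcases hz.eq_or_lt with rfl | hz
  · rw [Real.zero_rpow hg0.ne', mul_zero, hy.apply_zero]
  have hi := fun {a b w : ℝ} => hy.intervalIntegrable hα0 hα1 hm (a := a) (b := b) (z := w)
  set r : ℝ → ℝ := fun w => y w / w ^ g with hr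
  -- A priori bound, not sharp: `y(u) ≤ y(w)` and `w-u ≤ w` inside the integral give `y(w)^m ≤ B
  -- w^(2-α)`.
  have hupp : ∀ w ∈ Ioc 0 Z, r w ≤ B ^ m⁻¹ := by
    intro w hw
    have hw1 : w < 1 := by linarith [hw.2]
    have hyw := hy.pos w ⟨hw.1, hw1.le⟩
    have hw0 := hw.1
    have h1 : y w ^ m ≤ B * w ^ (2 - α) := by
      apply rpow_le_of_rpow_add_one_le_mul hyw
      rw [hy.eqn w ⟨hw.1.le, hw1.le⟩]
      have h2 : ∫ u in (0:ℝ)..w, kernel α m w u * y u ≤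
          ∫ u in (0:ℝ)..w, B * w ^ (1 - α) * y w := by
        refine intervalIntegral.integral_mono_on hw.1.le (hi le_rfl hw.1.le le_rfl hw1)
          (by simp) fun u hu => ?_
        have h3 := hy.le_of_le hα0 hα1 hm hu.1 hu.2 hw1
        have h4 := hK u w hu.1 hu.2 hw.2
        have h5 : (w - u) ^ (1 - α) ≤ w ^ (1 - α) := by
          apply Real.rpow_le_rpow <;> linarith [hu.1, hu.2]
        have h6 : kernel α m w u ≤ B * w ^ (1 - α) := h4.trans (by gcongr)
        exact mul_le_mul h6 h3 (hy.nonneg u ⟨hu.1, by linarith [hu.2]⟩) (by positivity)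
      refine h2.trans (le_of_eq ?_)
      rw [intervalIntegral.integral_const, smul_eq_mul, sub_zero,
        show 2 - α = 1 + (1 - α) by ring, Real.rpow_add hw.1, Real.rpow_one]
      ring
    simp only [hr]
    rw [div_le_iff₀ (by positivity)]
    have h := Real.rpow_le_rpow (by positivity) h1 (show 0 ≤ m⁻¹ by positivity)
    rwa [← Real.rpow_mul hyw.le, mul_inv_cancel₀ hm.ne', Real.rpow_one,
      Real.mul_rpow (by positivity) (by positivity), ← Real.rpow_mul hw.1.le, ← hg,
      mul_inv_cancel_right₀ hm.ne'] at h
  set S := r '' Ioc 0 Z with hS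
  have hbdd : BddAbove S := ⟨_, by rintro _ ⟨w, hw, rfl⟩; exact hupp w hw⟩
  have hne : S.Nonempty := ⟨_, z, ⟨hz, hzZ⟩, rfl⟩
  set l := sSup S with hl
  have hyl : ∀ w ∈ Ioc 0 Z, y w ≤ l * w ^ g := by
    intro w hw
    have h1 : 0 < w := hw.1
    have : r w ≤ l := le_csSup hbdd ⟨w, hw, rfl⟩
    rwa [hr, div_le_iff₀ (by positivity)] at this
  have hl0 : 0 < l := by
    have h1 := hyl z ⟨hz, hzZ⟩
    have h2 := hy.pos z ⟨hz, by linarith⟩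
    have h3 : 0 < z ^ g := by positivity
    exact pos_of_mul_pos_left (h2.trans_le h1) h3.le
  have hstep : ∀ w ∈ Ioc 0 Z, y w ^ (m + 1) ≤ B * l * betaInt α g * w ^ (2 - α + g) := by
    intro w hw
    have hw1 : w < 1 := by linarith [hw.2]
    rw [hy.eqn w ⟨hw.1.le, hw1.le⟩, mul_assoc, ← integral_sub_rpow_mul_rpow hw.1,
      ← intervalIntegral.integral_const_mul]
    refine intervalIntegral.integral_mono_on_of_le_Ioo hw.1.le (hi le_rfl hw.1.le le_rfl hw1)
      ((intervalIntegrable_sub_rpow_mul_rpow hα1 (by linarith) _ _ _).const_mul _) fun u hu => ?_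
    have h3 := hK u w hu.1.le hu.2.le hw.2
    have h4 := hyl u ⟨hu.1, by linarith [hu.2, hw.2]⟩
    have h6 : 0 < w - u := by linarith [hu.2]
    calc kernel α m w u * y u ≤ (B * (w - u) ^ (1 - α)) * (l * u ^ g) :=
          mul_le_mul h3 h4 (hy.nonneg u ⟨hu.1.le, by linarith [hu.2]⟩) (by positivity)
      _ = _ := by ring
  have hrl : ∀ w ∈ Ioc 0 Z, r w ≤ (B * l * betaInt α g) ^ (m + 1)⁻¹ := by
    intro w hw
    have h1 : 0 < w := hw.1
    have hyw : 0 < y w := hy.pos w ⟨by linarith [hw.1], by linarith [hw.2]⟩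
    have hrw : 0 ≤ r w := by simp only [hr]; positivity
    rw [Real.le_rpow_inv_iff_of_pos hrw (by positivity) (by linarith), hr,
      Real.div_rpow hyw.le (by positivity), ← Real.rpow_mul h1.le, div_le_iff₀ (by positivity),
      show g * (m + 1) = 2 - α + g by rw [← hg]; ring]
    exact hstep w hw
  have hll : l ^ m ≤ B * betaInt α g := by
    apply rpow_le_of_rpow_add_one_le_mul hl0
    have h1 : l ≤ (B * l * betaInt α g) ^ (m + 1)⁻¹ :=
      csSup_le hne (by rintro _ ⟨w, hw, rfl⟩; exact hrl w hw)
    rw [Real.le_rpow_inv_iff_of_pos hl0.le (by positivity) (by linarith)] at h1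
    linarith
  refine (hyl z ⟨hz, hzZ⟩).trans ?_
  gcongr
  rwa [Real.le_rpow_inv_iff_of_pos hl0.le (by positivity) hm]

end IsNontrivialSolution

/-! ### Discrete comparison principle -/

/-- A weighted discrete inequality `x_n^(m+1) ≤ (1 + C/n) ∑_{i<n} p_{n,i} x_i`, with weights of
total mass `1 + O(1/n)` which contract the sequence `w` by more than a factor `m + 1`, forces
`x_n ≤ 1 + O(w_n)`. -/
lemma exists_le_one_add_mul {m C ε T : ℝ} (n₀ : ℕ) (hm : 0 < m) (hC : 0 ≤ C)
    (hε : 0 < ε) (hε1 : ε < 1) (hn₀ : 1 ≤ n₀) (hCn : C / n₀ ≤ ε) (hT : 0 ≤ T) :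
    ∃ M : ℝ, 0 ≤ M ∧ ∀ (P : ℕ) (p : ℕ → ℕ → ℝ) (w x : ℕ → ℝ),
      (∀ n i, 2 ≤ n → n ≤ P → i < n → 0 ≤ p n i) →
      (∀ n, 2 ≤ n → n ≤ P → p n 0 = 0) →
      (∀ n, 2 ≤ n → n ≤ P → ∑ i ∈ Finset.range n, p n i ≤ 1 + C / n) →
      (∀ n, n₀ ≤ n → 2 ≤ n → n ≤ P →
        ∑ i ∈ Finset.range n, p n i * w i ≤ (1 - ε) * (m + 1) * w n) →
      (∀ n : ℕ, 1 ≤ n → 1 / (n : ℝ) ≤ w n) →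
      (∀ n, 1 ≤ n → n ≤ P → 0 ≤ x n) → x 1 ≤ T →
      (∀ n, 2 ≤ n → n ≤ P →
        x n ^ (m + 1) ≤ (1 + C / n) * ∑ i ∈ Finset.range n, p n i * x i) →
      ∀ n, 1 ≤ n → n ≤ P → x n ≤ 1 + M * w n := by
  -- Chosen so that `T'^m ≥ (1+C)^2`, which makes the constant `T'` a supersolution at every `n`.
  set T' := max T ((1 + C) ^ (2 / m)) with hT'
  have hT0 : 0 ≤ T' := hT.trans (le_max_left _ _)
  have hTm : (1 + C) * (1 + C) ≤ T' ^ m := by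
    have h1 : ((1 + C) ^ (2 / m)) ^ m ≤ T' ^ m := by
      gcongr
      exact le_max_right _ _
    rw [← Real.rpow_mul (by positivity), div_mul_cancel₀ _ hm.ne'] at h1
    calc (1 + C) * (1 + C) = (1 + C) ^ (2 : ℝ) := by norm_cast; ring
      _ ≤ _ := h1
  -- The first entry covers `n < n₀`, where `w_n ≥ 1/n` and the crude bound `T'` suffice. The second
  -- closes the induction: `(1+ε)(1-ε) = 1-ε²` leaves a margin `ε² (m+1) M w_n` to absorb the
  -- consistency error `C (2+C) w_n`.
  refine ⟨max (T' * n₀) (C * (2 + C) / (ε ^ 2 * (m + 1))), le_max_of_le_left (by positivity), ?_⟩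
  set M := max (T' * n₀) (C * (2 + C) / (ε ^ 2 * (m + 1))) with hM
  have hM0 : 0 ≤ M := le_max_of_le_left (by positivity)
  intro P p w x hp hp0 hsum hw hwn hx hx1 hrec
  have hCn1 : ∀ n : ℕ, 1 ≤ n → C / n ≤ C := by
    intro n hn
    exact div_le_self hC (by exact_mod_cast hn)
  have hmono : ∀ n, 2 ≤ n → n ≤ P → ∀ f f' : ℕ → ℝ, (∀ i, 1 ≤ i → i < n → f i ≤ f' i) →
      ∑ i ∈ Finset.range n, p n i * f i ≤ ∑ i ∈ Finset.range n, p n i * f' i := by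
    intro n hn2 hnP f f' hff
    refine Finset.sum_le_sum fun i hi => ?_
    rw [Finset.mem_range] at hi
    rcases Nat.eq_zero_or_pos i with rfl | hi0
    · rw [hp0 n hn2 hnP]; simp
    · exact mul_le_mul_of_nonneg_left (hff i hi0 hi) (hp n i hn2 hnP hi)
  have hcrude : ∀ n, 1 ≤ n → n ≤ P → x n ≤ T' := by
    intro n
    induction n using Nat.strong_induction_on with
    | _ n ih =>
      intro hn1 hnP
      rcases hn1.eq_or_lt with rfl | hn2
      · exact hx1.trans (le_max_left _ _)
      have hn2 : 2 ≤ n := hn2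
      have h1 := hmono n hn2 hnP x (fun _ => T') fun i hi hin => ih i hin hi (by omega)
      rw [← Finset.sum_mul] at h1
      have h2 : (1 + C / n) ≤ 1 + C := by linarith [hCn1 n hn1]
      have h3 : x n ^ (m + 1) ≤ T' ^ (m + 1) := by
        calc x n ^ (m + 1) ≤ (1 + C / n) * ∑ i ∈ Finset.range n, p n i * x i := hrec n hn2 hnP
          _ ≤ (1 + C / n) * ((1 + C / n) * T') := by
            refine mul_le_mul_of_nonneg_left (h1.trans ?_) (by positivity)
            exact mul_le_mul_of_nonneg_right (hsum n hn2 hnP) hT0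
          _ ≤ (1 + C) * ((1 + C) * T') := by gcongr
          _ = (1 + C) * (1 + C) * T' := by ring
          _ ≤ T' ^ m * T' := by gcongr
          _ = _ := (rpow_add_one' hT0 hm).symm
      exact (Real.rpow_le_rpow_iff (hx n hn1 hnP) hT0 (by linarith)).1 h3
  intro n
  induction n using Nat.strong_induction_on with
  | _ n ih =>
    intro hn1 hnP
    have hn0' : (0 : ℝ) < n := by exact_mod_cast hn1
    have hwn' := hwn n hn1
    have hw0 : 0 ≤ w n := le_trans (by positivity) hwn'
    by_cases hsmall : n < n₀ ∨ n < 2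
    · have hnn : (n : ℝ) ≤ n₀ := by
        norm_cast; omega
      have h1 := hcrude n hn1 hnP
      have h2 : T' ≤ M * w n := by
        calc T' = T' * n * (1 / n) := by field_simp
          _ ≤ T' * n₀ * w n := by gcongr
          _ ≤ M * w n := by gcongr; exact le_max_left _ _
      linarith
    · obtain ⟨hnn, hn2⟩ : n₀ ≤ n ∧ 2 ≤ n := by omega
      have h1 := hmono n hn2 hnP x (fun i => 1 + M * w i) fun i hi hin => ih i hin hi (by omega)
      have h2 : ∑ i ∈ Finset.range n, p n i * (1 + M * w i) =
          ∑ i ∈ Finset.range n, p n i + M * ∑ i ∈ Finset.range n, p n i * w i := by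
        rw [Finset.mul_sum, ← Finset.sum_add_distrib]
        exact Finset.sum_congr rfl fun i _ => by ring
      have h3 := hsum n hn2 hnP
      have h4 := hw n hnn hn2 hnP
      have hCε : C / n ≤ ε := by
        refine le_trans ?_ hCn
        have : (0 : ℝ) < n₀ := by exact_mod_cast hn₀
        gcongr
      have hCC : C / n ≤ C := hCn1 n hn1
      have hCn0 : 0 ≤ C / n := by positivity
      have hCw : C / n ≤ C * w n := by
        rw [div_eq_mul_one_div]; gcongr
      have h5 : C * (2 + C) ≤ M * (ε ^ 2 * (m + 1)) := by
        rw [← div_le_iff₀ (by positivity)]; exact le_max_right _ _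
      have hMw : 0 ≤ (m + 1) * (M * w n) := by positivity
      have h6 : x n ^ (m + 1) ≤ 1 + (m + 1) * (M * w n) := by
        calc x n ^ (m + 1) ≤ (1 + C / n) * ∑ i ∈ Finset.range n, p n i * x i := hrec n hn2 hnP
          _ ≤ (1 + C / n) * (1 + C / n + M * ((1 - ε) * (m + 1) * w n)) := by
            refine mul_le_mul_of_nonneg_left ?_ (by positivity)
            rw [h2] at h1
            exact h1.trans (add_le_add h3 (mul_le_mul_of_nonneg_left h4 hM0))
          _ = 1 + C / n * (2 + C / n) + (1 + C / n) * (1 - ε) * ((m + 1) * (M * w n)) := by ring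
          _ ≤ 1 + C * w n * (2 + C) + (1 + ε) * (1 - ε) * ((m + 1) * (M * w n)) := by
            have : 0 ≤ 1 - ε := by linarith
            gcongr
          _ = 1 + (m + 1) * (M * w n) + (C * (2 + C) - M * (ε ^ 2 * (m + 1))) * w n := by ring
          _ ≤ _ := by
            have := mul_nonneg (sub_nonneg.2 h5) hw0
            linarith
      -- Bernoulli: this is where the power `m+1` gains the factor `m+1`.
      have h7 : 1 + (m + 1) * (M * w n) ≤ (1 + M * w n) ^ (m + 1) :=
        one_add_mul_self_le_rpow_one_add (by have := mul_nonneg hM0 hw0; linarith) (by linarith)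
      have h8 : 0 ≤ 1 + M * w n := by positivity
      exact (Real.rpow_le_rpow_iff (hx n hn1 hnP) h8 (by linarith)).1 (h6.trans h7)

/-- Comparison of the solution `Y` of a discrete recurrence `Y_n^(m+1) = ∑_{i<n} W_{n,i} Y_i`
with an approximate solution `a`. -/
lemma exists_abs_sub_le {m C ε T V : ℝ} (n₀ : ℕ) (hm : 0 < m) (hC : 0 ≤ C)
    (hε : 0 < ε) (hε1 : ε < 1) (hn₀ : 1 ≤ n₀) (hCn : (2 * C + C ^ 2) / n₀ ≤ ε) (hT : 0 ≤ T) :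
    ∃ M : ℝ, 0 ≤ M ∧ ∀ (P : ℕ) (W : ℕ → ℕ → ℝ) (w a Y : ℕ → ℝ),
      (∀ n i, 2 ≤ n → n ≤ P → i < n → 0 ≤ W n i) →
      a 0 = 0 → Y 0 = 0 →
      (∀ n, 1 ≤ n → n ≤ P → 0 < a n) → (∀ n, 1 ≤ n → n ≤ P → 0 < Y n) →
      (∀ n, 2 ≤ n → n ≤ P → ∑ i ∈ Finset.range n, W n i * a i ≤ (1 + C / n) * a n ^ (m + 1)) →
      (∀ n, 2 ≤ n → n ≤ P → a n ^ (m + 1) ≤ (1 + C / n) * ∑ i ∈ Finset.range n, W n i * a i) →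
      (∀ n, 2 ≤ n → n ≤ P → Y n ^ (m + 1) = ∑ i ∈ Finset.range n, W n i * Y i) →
      (∀ n, n₀ ≤ n → 2 ≤ n → n ≤ P →
        ∑ i ∈ Finset.range n, W n i * (a i * w i) ≤ (1 - ε) * (m + 1) * w n * a n ^ (m + 1)) →
      (∀ n : ℕ, 1 ≤ n → 1 / (n : ℝ) ≤ w n) → (∀ n : ℕ, 1 ≤ n → w n ≤ V) →
      Y 1 ≤ T * a 1 → a 1 ≤ T * Y 1 →
      ∀ n, 1 ≤ n → n ≤ P → |Y n - a n| ≤ M * w n * a n := by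
  -- For `a/Y` the consistency error enters squared, and `(1+C/n)^2 ≤ 1 + (2C+C²)/n`.
  obtain ⟨M, hM0, hM⟩ := exists_le_one_add_mul (m := m) (C := 2 * C + C ^ 2) (ε := ε) (T := T)
    n₀ hm (by positivity) hε hε1 hn₀ hCn hT
  -- From `a ≤ (1 + M w) Y` comes `a - Y ≤ M w Y ≤ M w (1 + M w) a`, and `w ≤ V`.
  refine ⟨M * (1 + M * max V 0), by positivity, ?_⟩
  intro P W w a Y hW ha0 hY0 ha hY hA1 hA2 hrec hw hwn hwV hT1 hT2
  have hCC : ∀ n : ℕ, 1 ≤ n → (1 + C / n) * (1 + C / n) ≤ 1 + (2 * C + C ^ 2) / n := by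
    intro n hn
    have hn' : (1 : ℝ) ≤ n := by exact_mod_cast hn
    have h1 : C / n ≤ C := div_le_self hC hn'
    have h2 : 0 ≤ C / n := by positivity
    have h3 : (2 * C + C ^ 2) / n = 2 * (C / n) + C * (C / n) := by ring
    rw [h3]; nlinarith
  have hC1 : ∀ n : ℕ, 1 + C / n ≤ 1 + (2 * C + C ^ 2) / n := by
    intro n
    gcongr
    nlinarith [sq_nonneg C]
  set p : ℕ → ℕ → ℝ := fun n i => W n i * a i / a n ^ (m + 1) with hp
  have hapos : ∀ i n, i < n → n ≤ P → 0 ≤ a i := by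
    intro i n hin hnP
    rcases Nat.eq_zero_or_pos i with rfl | hi
    · exact ha0.ge
    · exact (ha i hi (by omega)).le
  have hanp : ∀ n, 1 ≤ n → n ≤ P → 0 < a n ^ (m + 1) := fun n h1 h2 =>
    Real.rpow_pos_of_pos (ha n h1 h2) _
  have hp_sum : ∀ (f : ℕ → ℝ) n, ∑ i ∈ Finset.range n, p n i * f i =
      (∑ i ∈ Finset.range n, W n i * (a i * f i)) / a n ^ (m + 1) := by
    intro f n
    rw [Finset.sum_div]
    exact Finset.sum_congr rfl fun i _ => by simp only [hp]; ring
  have hp_nonneg : ∀ n i, 2 ≤ n → n ≤ P → i < n → 0 ≤ p n i := fun n i h2 hP hi =>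
    div_nonneg (mul_nonneg (hW n i h2 hP hi) (hapos i n hi hP)) (hanp n (by omega) hP).le
  have hp_zero : ∀ n, 2 ≤ n → n ≤ P → p n 0 = 0 := fun n _ _ => by simp [hp, ha0]
  have hp_mass : ∀ n, 2 ≤ n → n ≤ P →
      ∑ i ∈ Finset.range n, p n i ≤ 1 + (2 * C + C ^ 2) / n := by
    intro n h2 hP
    have h := hp_sum (fun _ => 1) n
    simp only [mul_one] at h
    rw [h, div_le_iff₀ (hanp n (by omega) hP)]
    exact (hA1 n h2 hP).trans (mul_le_mul_of_nonneg_right (hC1 n) (hanp n (by omega) hP).le)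
  have hp_w : ∀ n, n₀ ≤ n → 2 ≤ n → n ≤ P →
      ∑ i ∈ Finset.range n, p n i * w i ≤ (1 - ε) * (m + 1) * w n := by
    intro n hn h2 hP
    rw [hp_sum, div_le_iff₀ (hanp n (by omega) hP)]
    exact hw n hn h2 hP
  have key1 := hM P p w (fun n => Y n / a n) hp_nonneg hp_zero hp_mass hp_w hwn
    (fun n h1 h2 => div_nonneg (hY n h1 h2).le (ha n h1 h2).le)
  have key2 := hM P p w (fun n => a n / Y n) hp_nonneg hp_zero hp_mass hp_w hwn
    (fun n h1 h2 => div_nonneg (ha n h1 h2).le (hY n h1 h2).le)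
  intro n hn1 hnP
  have hP1 : 1 ≤ P := hn1.trans hnP
  have hYn := hY n hn1 hnP
  have han := ha n hn1 hnP
  have hr1 : Y n / a n ≤ 1 + M * w n := by
    refine key1 ?_ ?_ n hn1 hnP
    · rw [div_le_iff₀ (ha 1 le_rfl hP1)]; exact hT1
    · intro n h2 hP
      have han := ha n (by omega) hP
      have h3 : ∑ i ∈ Finset.range n, p n i * (Y i / a i) = (Y n / a n) ^ (m + 1) := by
        rw [hp_sum, Real.div_rpow (hY n (by omega) hP).le han.le, hrec n h2 hP]
        congr 1
        refine Finset.sum_congr rfl fun i hi => ?_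
        rw [Finset.mem_range] at hi
        rcases Nat.eq_zero_or_pos i with rfl | hi0
        · simp [ha0, hY0]
        · rw [mul_div_cancel₀ _ (ha i hi0 (by omega)).ne']
      rw [h3]
      have : 0 ≤ (Y n / a n) ^ (m + 1) :=
        Real.rpow_nonneg (div_nonneg (hY n (by omega) hP).le han.le) _
      have : 0 ≤ (2 * C + C ^ 2) / n := by positivity
      nlinarith
  have hr2 : a n / Y n ≤ 1 + M * w n := by
    refine key2 ?_ ?_ n hn1 hnP
    · rw [div_le_iff₀ (hY 1 le_rfl hP1)]; exact hT2
    · intro n h2 hP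
      have hYn := hY n (by omega) hP
      have han := hanp n (by omega) hP
      have hYn' : 0 < Y n ^ (m + 1) := Real.rpow_pos_of_pos hYn _
      have hA2n := hA2 n h2 hP
      rw [hp_sum, Real.div_rpow (ha n (by omega) hP).le hYn.le]
      set A := ∑ i ∈ Finset.range n, W n i * a i with hA
      set B := ∑ i ∈ Finset.range n, W n i * (a i * (a i / Y i)) with hB
      -- Cauchy–Schwarz, with `W a` written as the geometric mean of `W Y` and `W a²/Y`. It turns
      -- the equation for `Y` into an upper inequality for `(a_n/Y_n)^(m+1)`, so no separate
      -- lower-bound argument is needed.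
      have hCS : A ^ 2 ≤ Y n ^ (m + 1) * B := by
        rw [hrec n h2 hP]
        refine Finset.sum_sq_le_sum_mul_sum_of_sq_le_mul _ ?_ ?_ ?_
        · intro i hi
          rw [Finset.mem_range] at hi
          rcases Nat.eq_zero_or_pos i with rfl | hi0
          · simp [hY0]
          · exact mul_nonneg (hW n i h2 hP hi) (hY i hi0 (by omega)).le
        · intro i hi
          rw [Finset.mem_range] at hi
          rcases Nat.eq_zero_or_pos i with rfl | hi0
          · simp [ha0]
          · have h1 := hY i hi0 (by omega)
            have h2' := ha i hi0 (by omega)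
            have := hW n i h2 hP hi
            positivity
        · intro i hi
          rw [Finset.mem_range] at hi
          rcases Nat.eq_zero_or_pos i with rfl | hi0
          · simp [ha0, hY0]
          · have h1 := hY i hi0 (by omega)
            refine le_of_eq ?_
            field_simp
      have hCn0 : 0 ≤ C / n := by positivity
      have hApos : 0 < A := by
        by_contra hneg
        push Not at hneg
        have : (1 + C / n) * A ≤ 0 := mul_nonpos_of_nonneg_of_nonpos (by positivity) hneg
        linarith
      have hB0 : 0 ≤ B := by
        have : 0 < Y n ^ (m + 1) * B := lt_of_lt_of_le (by positivity) hCS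
        exact (pos_of_mul_pos_right this hYn'.le).le
      rw [← mul_div_assoc, div_le_div_iff₀ hYn' han]
      calc a n ^ (m + 1) * a n ^ (m + 1)
          ≤ ((1 + C / n) * A) * ((1 + C / n) * A) := by gcongr
        _ = ((1 + C / n) * (1 + C / n)) * A ^ 2 := by ring
        _ ≤ (1 + (2 * C + C ^ 2) / n) * (Y n ^ (m + 1) * B) := by
          gcongr
          exact hCC n (by omega)
        _ = _ := by ring
  have hw0 : 0 ≤ w n := le_trans (by positivity) (hwn n hn1)
  have hwV' : w n ≤ max V 0 := (hwV n hn1).trans (le_max_left _ _)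
  rw [div_le_iff₀ han] at hr1
  rw [div_le_iff₀ hYn] at hr2
  have hMw : 0 ≤ M * w n := by positivity
  have hgoal : M * (1 + M * max V 0) * w n * a n ≥ M * w n * ((1 + M * w n) * a n) := by
    have : M * w n * ((1 + M * w n) * a n) ≤ M * w n * ((1 + M * max V 0) * a n) := by gcongr
    linarith
  have h1 : M * w n * a n ≤ M * w n * ((1 + M * w n) * a n) := by
    have h3 : a n ≤ (1 + M * w n) * a n := by nlinarith
    gcongr
  have h2 : M * w n * Y n ≤ M * w n * ((1 + M * w n) * a n) := by gcongr
  rw [abs_le]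
  constructor <;> linarith

/-! ### The scheme as a weighted sum; quadrature errors -/

/-- The weights of the scheme on an index of parity `k`, in units of `h`. -/
noncomputable def coef (k i : ℕ) : ℝ :=
  if i = k then 1 / 2 else if k < i ∧ (i + k) % 2 = 1 then 2 else 0

lemma coef_nonneg (k i : ℕ) : 0 ≤ coef k i := by
  unfold coef; split_ifs <;> norm_num

lemma sum_coef_mul (F : ℕ → ℝ) {n k : ℕ} (hn : 1 ≤ n) (hk : k ≤ 1) :
    ∑ i ∈ Finset.range (2 * n + k), coef k i * F i =
      1 / 2 * F k + 2 * ∑ i ∈ Finset.Icc 1 n, F (2 * i + k - 1) := by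
  induction n, hn using Nat.le_induction with
  | base =>
    interval_cases k <;> simp [Finset.sum_range_succ, coef]
  | succ n hn ih =>
    rw [Finset.sum_Icc_succ_top (by omega), mul_add (2 : ℝ), ← add_assoc, ← ih,
      show 2 * (n + 1) + k = 2 * n + k + 1 + 1 by ring, Finset.sum_range_succ,
      Finset.sum_range_succ, show 2 * n + k + 1 + 1 - 1 = 2 * n + k + 1 by omega]
    have h1 : coef k (2 * n + k) = 0 := by
      unfold coef
      rw [if_neg (by omega), if_neg (by omega)]
    have h2 : coef k (2 * n + k + 1) = 2 := by
      unfold coef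
      rw [if_neg (by omega), if_pos (by omega)]
    rw [h1, h2]; ring

/-- The weight of `Y i` in the scheme for `Y n`. -/
noncomputable def weight (α m : ℝ) (N n i : ℕ) : ℝ :=
  step N * kernel α m (node N n) (node N i) * coef (n % 2) i

lemma exists_eq_two_mul_add {n : ℕ} (hn : 2 ≤ n) :
    ∃ j k, 1 ≤ j ∧ k ≤ 1 ∧ n = 2 * j + k ∧ n % 2 = k :=
  ⟨n / 2, n % 2, by omega, by omega, by omega, rfl⟩

lemma sum_weight_mul {α m : ℝ} {N j k : ℕ} (hj : 1 ≤ j) (hk : k ≤ 1) (f : ℕ → ℝ) :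
    ∑ i ∈ Finset.range (2 * j + k), weight α m N (2 * j + k) i * f i =
      1 / 2 * step N * kernel α m (node N (2 * j + k)) (node N k) * f k +
      2 * step N * ∑ i ∈ Finset.Icc 1 j,
        kernel α m (node N (2 * j + k)) (node N (2 * i + k - 1)) * f (2 * i + k - 1) := by
  have h := sum_coef_mul (fun i => step N * (kernel α m (node N (2 * j + k)) (node N i) * f i))
    hj hk
  rw [← Finset.mul_sum] at h
  have hk2 : (2 * j + k) % 2 = k := by omega
  calc _ = ∑ i ∈ Finset.range (2 * j + k),
        coef k i * (step N * (kernel α m (node N (2 * j + k)) (node N i) * f i)) := by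
        refine Finset.sum_congr rfl fun i _ => ?_
        rw [weight, hk2]; ring
    _ = _ := by rw [h]; ring

lemma IsMidpointApprox.rpow_eq_sum {α m κ : ℝ} {N : ℕ} {Y : ℕ → ℝ}
    (hY : IsMidpointApprox α m κ N Y) {n : ℕ} (hn : 2 ≤ n) (hnN : n ≤ N) :
    Y n ^ (m + 1) = ∑ i ∈ Finset.range n, weight α m N n i * Y i := by
  obtain ⟨j, k, hj, hk, rfl, -⟩ := exists_eq_two_mul_add hn
  rw [hY.recurrence j k hj hk hnN, sum_weight_mul hj hk]

lemma step_nonneg (N : ℕ) : 0 ≤ step N := by unfold step; positivity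

lemma node_eq_mul_step (N n : ℕ) : node N n = n * step N := by
  unfold node step; ring

lemma node_nonneg (N n : ℕ) : 0 ≤ node N n := by unfold node; positivity

lemma node_mono (N : ℕ) : Monotone (node N) := by
  intro a b hab
  unfold node
  have : (a : ℝ) ≤ b := by exact_mod_cast hab
  gcongr

lemma node_zero (N : ℕ) : node N 0 = 0 := by simp [node]

lemma node_one (N : ℕ) : node N 1 = step N := by simp [node, step]

lemma node_succ (N n : ℕ) : node N (n + 1) = node N n + step N := by
  rw [node_eq_mul_step, node_eq_mul_step]; push_cast; ring

/-- Midpoint rule on one cell for the product of a decreasing and an increasing function. -/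
lemma abs_midpoint_sub_integral_le {F G : ℝ → ℝ} {a b c : ℝ} (hab : a ≤ b) (hbc : b ≤ c)
    (hF : AntitoneOn F (Icc a c)) (hG : MonotoneOn G (Icc a c))
    (hF0 : ∀ u ∈ Icc a c, 0 ≤ F u) (hG0 : ∀ u ∈ Icc a c, 0 ≤ G u)
    (hi : IntervalIntegrable (fun u => F u * G u) MeasureTheory.volume a c) :
    |(c - a) * (F b * G b) - ∫ u in a..c, F u * G u| ≤ (c - a) * (F a * G c - F c * G a) := by
  have hac := hab.trans hbc
  have ha : a ∈ Icc a c := ⟨le_rfl, hac⟩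
  have hc : c ∈ Icc a c := ⟨hac, le_rfl⟩
  have hup : ∀ u ∈ Icc a c, F u * G u ≤ F a * G c := fun u hu =>
    mul_le_mul (hF ha hu hu.1) (hG hu hc hu.2) (hG0 u hu) (hF0 a ha)
  have hlo : ∀ u ∈ Icc a c, F c * G a ≤ F u * G u := fun u hu =>
    mul_le_mul (hF hu hc hu.2) (hG ha hu hu.1) (hG0 a ha) (hF0 u hu)
  have h1 : ∫ u in a..c, F u * G u ≤ (c - a) * (F a * G c) := by
    have := intervalIntegral.integral_mono_on hac hi (by simp) hup
    rwa [intervalIntegral.integral_const, smul_eq_mul] at this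
  have h2 : (c - a) * (F c * G a) ≤ ∫ u in a..c, F u * G u := by
    have := intervalIntegral.integral_mono_on hac (by simp) hi hlo
    rwa [intervalIntegral.integral_const, smul_eq_mul] at this
  have h3 := mul_le_mul_of_nonneg_left (hup b ⟨hab, hbc⟩) (sub_nonneg.2 hac)
  have h4 := mul_le_mul_of_nonneg_left (hlo b ⟨hab, hbc⟩) (sub_nonneg.2 hac)
  rw [abs_le]
  constructor <;> linarith

/-- The composite midpoint rule, with the error bounded by the total variations. -/
lemma abs_sum_sub_integral_le {F G : ℝ → ℝ} {N n k : ℕ}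
    (hF : AntitoneOn F (Icc 0 (node N n))) (hG : MonotoneOn G (Icc 0 (node N n)))
    (hF0 : ∀ u ∈ Icc 0 (node N n), 0 ≤ F u) (hG0 : ∀ u ∈ Icc 0 (node N n), 0 ≤ G u)
    (hi : ∀ a b, 0 ≤ a → a ≤ b → b ≤ node N n →
      IntervalIntegrable (fun u => F u * G u) MeasureTheory.volume a b)
    (j : ℕ) (hj : 2 * j + k ≤ n) :
    |2 * step N * ∑ i ∈ Finset.Icc 1 j, F (node N (2 * i + k - 1)) * G (node N (2 * i + k - 1)) -
      ∫ u in node N k..node N (2 * j + k), F u * G u| ≤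
      2 * step N * ((F (node N k) - F (node N (2 * j + k))) * G (node N n) +
        F 0 * (G (node N (2 * j + k)) - G (node N k))) := by
  have hmem : ∀ i, i ≤ n → node N i ∈ Icc 0 (node N n) := fun i h =>
    ⟨node_nonneg N i, node_mono N h⟩
  induction j with
  | zero => simp
  | succ j ih =>
    have ih := ih (by omega)
    set a := node N (2 * j + k) with ha
    set b := node N (2 * j + k + 1) with hb
    set c := node N (2 * j + k + 1 + 1) with hc
    have hab : b = a + step N := node_succ _ _
    have hbc : c = b + step N := node_succ _ _
    have hst := step_nonneg N
    have ham : a ∈ Icc 0 (node N n) := hmem _ (by omega)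
    have hcm : c ∈ Icc 0 (node N n) := hmem _ (by omega)
    have hsub : Icc a c ⊆ Icc 0 (node N n) := Icc_subset_Icc ham.1 hcm.2
    have hcell := abs_midpoint_sub_integral_le (F := F) (G := G) (a := a) (b := b) (c := c)
      (by linarith) (by linarith) (hF.mono hsub) (hG.mono hsub) (fun u hu => hF0 u (hsub hu))
      (fun u hu => hG0 u (hsub hu)) (hi a c ham.1 (by linarith) hcm.2)
    rw [show c - a = 2 * step N by linarith] at hcell
    rw [Finset.sum_Icc_succ_top (by omega),
      show 2 * (j + 1) + k - 1 = 2 * j + k + 1 by omega,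
      show 2 * (j + 1) + k = 2 * j + k + 1 + 1 by ring, ← hb, ← hc,
      ← intervalIntegral.integral_add_adjacent_intervals
        (hi (node N k) a (node_nonneg _ _) (node_mono N (by omega)) ham.2)
        (hi a c ham.1 (by linarith) hcm.2), mul_add]
    have hbound : F a * G c - F c * G a ≤ (F a - F c) * G (node N n) + F 0 * (G c - G a) := by
      have h1 : F c ≤ F a := hF ham hcm (by linarith)
      have h2 : G a ≤ G c := hG ham hcm (by linarith)
      have h3 : G c ≤ G (node N n) := hG hcm (hmem n le_rfl) hcm.2
      have h4 : F c ≤ F 0 := hF ⟨le_rfl, ham.1.trans ham.2⟩ hcm hcm.1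
      nlinarith
    have hbound' := mul_le_mul_of_nonneg_left hbound (show 0 ≤ 2 * step N by positivity)
    rw [abs_le] at ih hcell ⊢
    constructor <;> linarith [ih.1, ih.2, hcell.1, hcell.2]

/-- Of the factor `5`, four come from `2h` times the variations of the kernel and of `y`, and one
from the initial piece `[0,z_k]`, where quadrature term and integral both lie between `0` and `h
K(z,0) y(z)`. -/
lemma IsNontrivialSolution.abs_sum_weight_sub_le {α m : ℝ} {y : ℝ → ℝ}
    (hy : IsNontrivialSolution α m y) (hα0 : 0 < α) (hα1 : α < 1) (hm : 0 < m)
    {N n : ℕ} (hn : 2 ≤ n) (hz1 : node N n < 1) :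
    |∑ i ∈ Finset.range n, weight α m N n i * y (node N i) - y (node N n) ^ (m + 1)| ≤
      5 * step N * (kernel α m (node N n) 0 * y (node N n)) := by
  obtain ⟨j, k, hj, hk, hnjk, -⟩ := exists_eq_two_mul_add hn
  set z := node N n with hz
  have hz0 : 0 ≤ z := node_nonneg _ _
  have hst := step_nonneg N
  have hF : AntitoneOn (kernel α m z) (Icc 0 z) := fun u hu v hv huv =>
    kernel_le_kernel hα0 hα1 hm huv hv.2 le_rfl hz1
  have hG : MonotoneOn y (Icc 0 z) := fun u hu v hv huv =>
    hy.le_of_le hα0 hα1 hm hu.1 huv (by linarith [hv.2])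
  have hF0 : ∀ u ∈ Icc 0 z, 0 ≤ kernel α m z u := fun u hu =>
    kernel_nonneg hα0 hα1 hm hu.1 hu.2 hz1
  have hG0 : ∀ u ∈ Icc 0 z, 0 ≤ y u := fun u hu => hy.nonneg u ⟨hu.1, by linarith [hu.2]⟩
  have hi : ∀ a b, 0 ≤ a → a ≤ b → b ≤ z →
      IntervalIntegrable (fun u => kernel α m z u * y u) MeasureTheory.volume a b :=
    fun a b h1 h2 h3 => hy.intervalIntegrable hα0 hα1 hm h1 h2 h3 hz1
  have hmain := abs_sum_sub_integral_le (k := k) hF hG hF0 hG0 hi j (by omega)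
  rw [← hnjk, ← hz] at hmain
  have hsum := sum_weight_mul (α := α) (m := m) (N := N) hj hk (fun i => y (node N i))
  rw [← hnjk, ← hz] at hsum
  have h0m : (0 : ℝ) ∈ Icc 0 z := ⟨le_rfl, hz0⟩
  have hzm : z ∈ Icc 0 z := ⟨hz0, le_rfl⟩
  have hkm : node N k ∈ Icc 0 z := ⟨node_nonneg _ _, node_mono N (by omega)⟩
  have hkh : node N k ≤ step N := by
    rw [← node_one]; exact node_mono N hk
  have hup : ∀ u ∈ Icc 0 z, kernel α m z u * y u ≤ kernel α m z 0 * y z := fun u hu =>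
    mul_le_mul (hF h0m hu hu.1) (hG hu hzm hu.2) (hG0 u hu) (hF0 0 h0m)
  have hKy : 0 ≤ kernel α m z 0 * y z := mul_nonneg (hF0 0 h0m) (hG0 z hzm)
  have hfirst : 0 ≤ ∫ u in (0 : ℝ)..node N k, kernel α m z u * y u :=
    intervalIntegral.integral_nonneg hkm.1 fun u hu =>
      mul_nonneg (hF0 u ⟨hu.1, hu.2.trans hkm.2⟩) (hG0 u ⟨hu.1, hu.2.trans hkm.2⟩)
  have hfirst' : ∫ u in (0 : ℝ)..node N k, kernel α m z u * y u ≤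
      step N * (kernel α m z 0 * y z) := by
    have := intervalIntegral.integral_mono_on hkm.1 (hi 0 _ le_rfl hkm.1 hkm.2)
      (by simp) fun u hu => hup u ⟨hu.1, hu.2.trans hkm.2⟩
    rw [intervalIntegral.integral_const, smul_eq_mul, sub_zero] at this
    exact this.trans (by gcongr)
  have hterm : 0 ≤ 1 / 2 * step N * kernel α m z (node N k) * y (node N k) := by
    rw [mul_assoc]
    exact mul_nonneg (by positivity) (mul_nonneg (hF0 _ hkm) (hG0 _ hkm))
  have hterm' : 1 / 2 * step N * kernel α m z (node N k) * y (node N k) ≤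
      step N * (kernel α m z 0 * y z) := by
    have h1 := mul_le_mul_of_nonneg_left (hup _ hkm) (show 0 ≤ 1 / 2 * step N by positivity)
    have h2 := mul_nonneg hst hKy
    linarith
  have hvar : (kernel α m z (node N k) - kernel α m z z) * y z +
      kernel α m z 0 * (y z - y (node N k)) ≤ 2 * (kernel α m z 0 * y z) := by
    have h1 := hF h0m hkm hkm.1
    have h2 := hF0 z hzm
    have h3 := hG0 z hzm
    have h4 := hG0 _ hkm
    have h5 := hF0 0 h0m
    nlinarith
  have hvar' := mul_le_mul_of_nonneg_left hvar (show 0 ≤ 2 * step N by positivity)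
  rw [hy.eqn z ⟨hz0, hz1.le⟩, ← intervalIntegral.integral_add_adjacent_intervals
    (hi 0 _ le_rfl hkm.1 hkm.2) (hi _ z hkm.1 hkm.2 le_rfl), hsum]
  rw [abs_le] at hmain ⊢
  constructor <;> linarith [hmain.1, hmain.2]

/-- The composite midpoint rule overestimates the integral of a decreasing function by at most the
contribution of the first cell. -/
lemma sum_le_integral_of_antitoneOn {g : ℝ → ℝ} {N n k : ℕ} (hN : 1 ≤ N)
    (hg : AntitoneOn g (Ioc 0 (node N n))) (j : ℕ) (hj : 2 * j + k + 1 ≤ n) :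
    2 * step N * ∑ i ∈ Finset.Icc 1 (j + 1), g (node N (2 * i + k - 1)) ≤
      2 * step N * g (step N) + ∫ u in node N (k + 1)..node N (2 * j + k + 1), g u := by
  have hst : 0 < step N := by unfold step; positivity
  have hmem : ∀ i, 1 ≤ i → i ≤ n → node N i ∈ Ioc 0 (node N n) := fun i h1 h =>
    ⟨by rw [node_eq_mul_step]; positivity, node_mono N h⟩
  have hint : ∀ i i', 1 ≤ i → i ≤ i' → i' ≤ n →
      IntervalIntegrable g MeasureTheory.volume (node N i) (node N i') := by
    intro i i' h1 h2 h3
    refine (hg.mono ?_).intervalIntegrable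
    rw [uIcc_of_le (node_mono N h2)]
    exact fun u hu => ⟨(hmem i h1 (by omega)).1.trans_le hu.1, hu.2.trans (node_mono N h3)⟩
  induction j with
  | zero =>
    have h1 := hmem 1 le_rfl (by omega)
    have h2 := hg h1 (hmem (k + 1) (by omega) (by omega)) (node_mono N (by omega))
    rw [node_one] at h2
    simp only [Nat.zero_add, Finset.Icc_self, Finset.sum_singleton, mul_zero, mul_one,
      intervalIntegral.integral_same, add_zero]
    rw [show 2 + k - 1 = k + 1 by omega]
    gcongr
  | succ j ih =>
    have ih := ih (by omega)
    rw [Finset.sum_Icc_succ_top (by omega), mul_add]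
    rw [show 2 * (j + 1 + 1) + k - 1 = 2 * j + k + 1 + 1 + 1 by omega,
      show 2 * (j + 1) + k + 1 = 2 * j + k + 1 + 1 + 1 by ring,
      ← intervalIntegral.integral_add_adjacent_intervals
        (hint (k + 1) (2 * j + k + 1) (by omega) (by omega) (by omega))
        (hint (2 * j + k + 1) (2 * j + k + 1 + 1 + 1) (by omega) (by omega) (by omega))]
    -- Each value is charged to the interval of length `2h` ending at its node, which starts at the
    -- previous midpoint. Only the first midpoint remains unpaired.
    have hcell : 2 * step N * g (node N (2 * j + k + 1 + 1 + 1)) ≤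
        ∫ u in node N (2 * j + k + 1)..node N (2 * j + k + 1 + 1 + 1), g u := by
      have hle := node_mono N (show 2 * j + k + 1 ≤ 2 * j + k + 1 + 1 + 1 by omega)
      have h1 := intervalIntegral.integral_mono_on hle
        (by simp : IntervalIntegrable (fun _ => g (node N (2 * j + k + 1 + 1 + 1)))
          MeasureTheory.volume _ _)
        (hint (2 * j + k + 1) (2 * j + k + 1 + 1 + 1) (by omega) (by omega) (by omega))
        fun u hu => hg ⟨(hmem (2 * j + k + 1) (by omega) (by omega)).1.trans_le hu.1,
          hu.2.trans (hmem _ (by omega) (by omega)).2⟩ (hmem _ (by omega) (by omega)) hu.2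
      rw [intervalIntegral.integral_const, smul_eq_mul, node_succ, node_succ] at h1
      rw [node_succ N (2 * j + k + 1 + 1), node_succ N (2 * j + k + 1)]
      linarith
    linarith

/-- The scheme applied to a power-like sequence. -/
lemma sum_weight_mul_le {α m B E s : ℝ} (hα0 : 0 < α) (hα1 : α < 1) (hm : 0 < m)
    (hB : 0 ≤ B) (hE : 0 ≤ E) (hs : -1 < s) (hs0 : s ≤ 0) {N n : ℕ} (hN : 1 ≤ N) (hn : 2 ≤ n)
    (hz1 : node N n < 1)
    (hK : ∀ u, 0 ≤ u → u ≤ node N n →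
      kernel α m (node N n) u ≤ B * (node N n - u) ^ (1 - α))
    {f : ℕ → ℝ} (hf0 : f 0 = 0) (hf : ∀ i, 1 ≤ i → i < n → f i ≤ E * node N i ^ s) :
    ∑ i ∈ Finset.range n, weight α m N n i * f i ≤
      B * E * (betaInt α s + 3 * (n : ℝ) ^ (-(1 + s))) * node N n ^ (2 - α + s) := by
  obtain ⟨j, k, hj, hk, hnjk, -⟩ := exists_eq_two_mul_add hn
  obtain ⟨j, rfl⟩ : ∃ i, j = i + 1 := ⟨j - 1, by omega⟩
  set z := node N n with hz
  have hst : 0 < step N := by unfold step; positivity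
  have hn0 : (0 : ℝ) < n := by exact_mod_cast (by omega : 0 < n)
  have hz0 : 0 < z := by rw [hz, node_eq_mul_step]; positivity
  set g : ℝ → ℝ := fun u => (z - u) ^ (1 - α) * u ^ s with hg
  have hganti : AntitoneOn g (Ioc 0 z) := by
    intro u hu v hv huv
    have h1 : 0 ≤ z - v := by linarith [hv.2]
    have h2 : v ^ s ≤ u ^ s := Real.rpow_le_rpow_of_nonpos hu.1 huv hs0
    have h3 : (z - v) ^ (1 - α) ≤ (z - u) ^ (1 - α) :=
      Real.rpow_le_rpow h1 (by linarith) (by linarith)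
    have h4 : 0 ≤ z - u := by linarith
    exact mul_le_mul h3 h2 (Real.rpow_nonneg hv.1.le _) (by positivity)
  have hg0 : ∀ u ∈ Icc 0 z, 0 ≤ g u := fun u hu =>
    mul_nonneg (Real.rpow_nonneg (by linarith [hu.2]) _) (Real.rpow_nonneg hu.1 _)
  have hterm : ∀ i, 1 ≤ i → i < n → kernel α m z (node N i) * f i ≤ B * E * g (node N i) := by
    intro i h1 h2
    have hi0 := node_nonneg N i
    have hiz : node N i ≤ z := node_mono N h2.le
    have h3 := kernel_nonneg hα0 hα1 hm hi0 hiz hz1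
    calc kernel α m z (node N i) * f i ≤ kernel α m z (node N i) * (E * node N i ^ s) :=
          mul_le_mul_of_nonneg_left (hf i h1 h2) h3
      _ ≤ (B * (z - node N i) ^ (1 - α)) * (E * node N i ^ s) :=
          mul_le_mul_of_nonneg_right (hK _ hi0 hiz) (by positivity)
      _ = _ := by simp only [hg]; ring
  have hstz : step N ≤ z := by rw [← node_one]; exact node_mono N (by omega)
  have hgst : 0 ≤ g (step N) := hg0 _ ⟨hst.le, hstz⟩
  have hfirst : 1 / 2 * step N * kernel α m z (node N k) * f k ≤
      1 * step N * (B * E * g (step N)) := by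
    have hR : 0 ≤ step N * (B * E * g (step N)) := by positivity
    rcases Nat.le_one_iff_eq_zero_or_eq_one.1 hk with rfl | rfl
    · rw [hf0, mul_zero]; linarith
    · have h1 := mul_le_mul_of_nonneg_left (hterm 1 le_rfl (by omega))
        (show 0 ≤ 1 / 2 * step N by positivity)
      rw [node_one] at h1 ⊢
      linarith
  have hsum := sum_weight_mul (α := α) (m := m) (N := N) hj hk f
  rw [← hnjk, ← hz] at hsum
  have hS : ∑ i ∈ Finset.Icc 1 (j + 1), kernel α m z (node N (2 * i + k - 1)) * f (2 * i + k - 1) ≤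
      B * E * ∑ i ∈ Finset.Icc 1 (j + 1), g (node N (2 * i + k - 1)) := by
    rw [Finset.mul_sum]
    refine Finset.sum_le_sum fun i hi => ?_
    rw [Finset.mem_Icc] at hi
    exact hterm _ (by omega) (by omega)
  have hS2 := sum_le_integral_of_antitoneOn (k := k) hN hganti j (by omega)
  have hgi : ∀ a b, IntervalIntegrable g MeasureTheory.volume a b := fun a b =>
    intervalIntegrable_sub_rpow_mul_rpow hα1 hs z a b
  have hI : ∫ u in node N (k + 1)..node N (2 * j + k + 1), g u ≤ ∫ u in (0 : ℝ)..z, g u := by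
    refine intervalIntegral.integral_mono_interval (node_nonneg _ _) (node_mono N (by omega))
      (node_mono N (by omega)) ?_ (hgi _ _)
    filter_upwards [MeasureTheory.ae_restrict_mem measurableSet_Ioc] with u hu
    exact hg0 u ⟨hu.1.le, hu.2⟩
  rw [integral_sub_rpow_mul_rpow hz0] at hI
  -- Since `h = z/n`, the unpaired terms are of relative size `n^(-(1+s))`, which decays because `s
  -- > -1`.
  have hgh : step N * g (step N) ≤ (n : ℝ) ^ (-(1 + s)) * z ^ (2 - α + s) := by
    have h1 : g (step N) ≤ z ^ (1 - α) * step N ^ s := by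
      simp only [hg]
      gcongr
      · linarith
    have hstep : step N = (n : ℝ)⁻¹ * z := by
      rw [hz, node_eq_mul_step]; field_simp
    have h2 : step N * step N ^ s = (n : ℝ) ^ (-(1 + s)) * z ^ (1 + s) := by
      rw [Real.rpow_neg hn0.le, ← Real.inv_rpow hn0.le, ← Real.mul_rpow (by positivity) hz0.le,
        ← hstep, Real.rpow_add hst, Real.rpow_one]
    calc step N * g (step N) ≤ step N * (z ^ (1 - α) * step N ^ s) := by gcongr
      _ = z ^ (1 - α) * (step N * step N ^ s) := by ring
      _ = (n : ℝ) ^ (-(1 + s)) * (z ^ (1 - α) * z ^ (1 + s)) := by rw [h2]; ring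
      _ = _ := by rw [← Real.rpow_add hz0]; congr 2; ring
  have hBE : 0 ≤ B * E := by positivity
  rw [hsum]
  calc _ ≤ 1 * step N * (B * E * g (step N)) + 2 * step N *
        (B * E * ∑ i ∈ Finset.Icc 1 (j + 1), g (node N (2 * i + k - 1))) := by gcongr
    _ = B * E * (step N * g (step N) +
        2 * step N * ∑ i ∈ Finset.Icc 1 (j + 1), g (node N (2 * i + k - 1))) := by ring
    -- The `3` collects one `h g(h)` from the half-weighted term at `z_k` and two from the first
    -- midpoint.
    _ ≤ B * E * (betaInt α s * z ^ (2 - α + s) +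
        3 * ((n : ℝ) ^ (-(1 + s)) * z ^ (2 - α + s))) := by
      refine mul_le_mul_of_nonneg_left ?_ hBE
      linarith
    _ = _ := by ring

/-! ### The order of convergence is below one -/

lemma Gamma_le_one {x : ℝ} (h1 : 1 ≤ x) (h2 : x ≤ 2) : Real.Gamma x ≤ 1 := by
  have h := Real.convexOn_Gamma.le_max_of_mem_Icc (x := 1) (y := 2) (z := x)
    (by simp) (by simp) ⟨h1, h2⟩
  simpa using h

lemma one_le_Gamma {x : ℝ} (h : 2 ≤ x) : 1 ≤ Real.Gamma x := by
  have := Real.Gamma_strictMonoOn_Ici.monotoneOn (mem_Ici.2 le_rfl) (mem_Ici.2 h) h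
  rwa [Real.Gamma_two] at this

lemma half_le_Gamma {x : ℝ} (h1 : 1 ≤ x) : 1 / 2 ≤ Real.Gamma x := by
  rcases le_total x 2 with h2 | h2
  · have h3 := one_le_Gamma (show 2 ≤ x + 1 by linarith)
    rw [Real.Gamma_add_one (by linarith)] at h3
    have h4 := Real.Gamma_pos_of_pos (show 0 < x by linarith)
    nlinarith
  · linarith [one_le_Gamma h2]

lemma half_rpow_le {α s : ℝ} (hα0 : 0 < α) (hα1 : α < 1) (hs : 1 ≤ s) :
    (α / 2) ^ s ≤ 1 / 2 := by
  calc (α / 2) ^ s ≤ (α / 2) ^ (1 : ℝ) :=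
        Real.rpow_le_rpow_of_exponent_ge (by positivity) (by linarith) hs
    _ ≤ 1 / 2 := by rw [Real.rpow_one]; linarith

/-- The Gamma quotient is at most `2`, and a factor `1/2` compensates: it is `(α/2)^(2-α)` in the
second branch and, after `Γ(g) = Γ(1+g)/g`, the reciprocal of `g (2-α+m(3-α)) ≥ 2` in the first. -/
lemma constC1_pos_le_one {α m : ℝ} (hα0 : 0 < α) (hα1 : α < 1) (hm : 2 - α < m) :
    0 < constC1 α m ∧ constC1 α m ≤ 1 := by
  have hm0 : 0 < m := by linarith
  set g := (2 - α) / m with hg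
  have hg0 : 0 < g := div_pos (by linarith) hm0
  have hg1 : g < 1 := (div_lt_one hm0).2 hm
  have hΓ1 : Real.Gamma (1 + g) ≤ 1 := Gamma_le_one (by linarith) (by linarith)
  have hΓ2 : 1 / 2 ≤ Real.Gamma (2 - α + g) := half_le_Gamma (by linarith)
  have hΓ10 : 0 < Real.Gamma (1 + g) := Real.Gamma_pos_of_pos (by linarith)
  have hΓ20 : 0 < Real.Gamma (2 - α + g) := by linarith
  have hratio : Real.Gamma (1 + g) / Real.Gamma (2 - α + g) ≤ 2 := by
    rw [div_le_iff₀ hΓ20]; linarith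
  have hexp : 0 < 1 / (m + 1) := by positivity
  have h2α : 0 < 2 - α := by linarith
  have h3α : 0 < 3 - α := by linarith
  unfold constC1
  split_ifs
  · rw [← hg]
    have hΓg : Real.Gamma g = Real.Gamma (1 + g) / g := by
      rw [add_comm, Real.Gamma_add_one hg0.ne']; field_simp
    have hΓg0 : 0 < Real.Gamma g := Real.Gamma_pos_of_pos hg0
    refine ⟨by positivity, Real.rpow_le_one (by positivity) ?_ hexp.le⟩
    have h1 : (α / 2) ^ (1 - α) ≤ 1 :=
      Real.rpow_le_one (by positivity) (by linarith) (by linarith)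
    have hden : 2 ≤ g * (2 - α + m * (3 - α)) := by
      have : g * m = 2 - α := by rw [hg]; field_simp
      have : g * (2 - α + m * (3 - α)) = g * (2 - α) + (2 - α) * (3 - α) := by
        rw [← this]; ring
      nlinarith [mul_pos hg0 h2α]
    have hrw : (α / 2) ^ (1 - α) * (Real.Gamma g / Real.Gamma (2 - α + g)) *
        (1 / (2 - α + m * (3 - α))) = (α / 2) ^ (1 - α) *
        (Real.Gamma (1 + g) / Real.Gamma (2 - α + g)) * (1 / (g * (2 - α + m * (3 - α)))) := by
      rw [hΓg]; field_simp
    rw [hrw]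
    calc _ ≤ 1 * 2 * (1 / 2 : ℝ) := by gcongr
      _ = 1 := by norm_num
  · rw [← hg]
    refine ⟨by positivity, Real.rpow_le_one (by positivity) ?_ hexp.le⟩
    have h1 : (α / 2) ^ (2 - α) ≤ 1 / 2 := half_rpow_le hα0 hα1 (by linarith)
    calc _ ≤ (1 / 2 : ℝ) * 2 * (1 / 1) := by
          gcongr
          linarith
      _ = 1 := by norm_num

/-- Since `C₁ ≤ 1`, `Γ(2-α) ≤ 1` and `1/(1-X) ≥ 1`, one has `A ≥ 1/m`, whence `ω ≤ 1 -
(1-α)(m-1)/m`. -/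
lemma order_lt_one {α m X : ℝ} (hα0 : 0 < α) (hα1 : α < 1) (hm : 2 - α < m)
    (hX0 : 0 ≤ X) (hX1 : X < 1) : order α m X < 1 := by
  have hm0 : 0 < m := by linarith
  obtain ⟨hC0, hC1⟩ := constC1_pos_le_one hα0 hα1 hm
  have hΓ : Real.Gamma (2 - α) ≤ 1 := Gamma_le_one (by linarith) (by linarith)
  have hΓ0 : 0 < Real.Gamma (2 - α) := Real.Gamma_pos_of_pos (by linarith)
  have hCm : constC1 α m ^ m ≤ 1 := Real.rpow_le_one hC0.le hC1 hm0.le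
  have hCm0 : 0 < constC1 α m ^ m := by positivity
  have hXp : 1 ≤ (1 / (1 - X)) ^ (1 - α) := by
    refine Real.one_le_rpow ?_ (by linarith)
    rw [le_div_iff₀ (by linarith)]; linarith
  have hA : 1 / m ≤ constA α m X := by
    have h1 : constA α m X = 1 / m * ((1 / (1 - X)) ^ (1 - α) /
        (Real.Gamma (2 - α) * constC1 α m ^ m)) := by
      unfold constA constD; field_simp
    have h2 : 1 ≤ (1 / (1 - X)) ^ (1 - α) / (Real.Gamma (2 - α) * constC1 α m ^ m) := by
      rw [le_div_iff₀ (by positivity)]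
      nlinarith
    rw [h1]
    exact le_mul_of_one_le_right (by positivity) h2
  have h3 : 2 - (2 - α) * (1 - 1 / m) - 1 / m - 1 = -((1 - α) * (m - 1) / m) := by
    field_simp; ring
  have h4 : 0 < (1 - α) * (m - 1) / m := by
    have : 0 < m - 1 := by linarith
    have : 0 < 1 - α := by linarith
    positivity
  unfold order
  linarith

/-! ### Amplification of power weights -/

/-- Lower bound for `K(z,u) (z-u)^(α-1)`, `z ≤ Z`. -/
noncomputable def lowC (α m Z : ℝ) : ℝ := kernelConst α m * (1 - Z) ^ 2

/-- Upper bound for `K(z,u) (z-u)^(α-1)`, `z ≤ Z`. -/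
noncomputable def uppC (α m Z : ℝ) : ℝ :=
  kernelConst α m * ((1 + 2 / α * Z) * (1 / (1 - Z)) ^ (1 - α))

section Bounds

variable {α m Z : ℝ}

lemma lowC_pos (hα0 : 0 < α) (hα1 : α < 1) (hm : 0 < m) (hZ1 : Z < 1) : 0 < lowC α m Z := by
  have := kernelConst_pos hα0 hα1 hm
  have : 0 < 1 - Z := by linarith
  unfold lowC; positivity

lemma uppC_pos (hα0 : 0 < α) (hα1 : α < 1) (hm : 0 < m) (hZ0 : 0 ≤ Z) (hZ1 : Z < 1) :
    0 < uppC α m Z := by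
  have := kernelConst_pos hα0 hα1 hm
  have : 0 < 1 - Z := by linarith
  unfold uppC; positivity

lemma lowC_mul_le (hα0 : 0 < α) (hα1 : α < 1) (hm : 0 < m) (hZ1 : Z < 1) (u z : ℝ)
    (hu : 0 ≤ u) (huz : u ≤ z) (hzZ : z ≤ Z) :
    lowC α m Z * (z - u) ^ (1 - α) ≤ kernel α m z u := by
  refine le_trans ?_ (le_kernel hα0 hα1 hm hu huz (by linarith))
  have := kernelConst_pos hα0 hα1 hm
  have h1 : 0 ≤ 1 - Z := by linarith
  have h2 : 0 ≤ z - u := by linarith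
  unfold lowC; gcongr

lemma le_uppC_mul (hα0 : 0 < α) (hα1 : α < 1) (hm : 0 < m) (hZ1 : Z < 1) (u z : ℝ)
    (hu : 0 ≤ u) (huz : u ≤ z) (hzZ : z ≤ Z) :
    kernel α m z u ≤ uppC α m Z * (z - u) ^ (1 - α) := by
  refine (kernel_le hα0 hα1 hm hu huz (by linarith)).trans ?_
  have := kernelConst_pos hα0 hα1 hm
  have h1 : 0 < 1 - Z := by linarith
  have h2 : 0 ≤ z - u := by linarith
  have h3 : 0 ≤ Z := by linarith
  have h4 : 0 < 1 - z := by linarith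
  have h5 : 0 ≤ 1 - α := by linarith
  unfold uppC; gcongr

/-- Lower bound for `y(z) z^(-g)`, `z ≤ Z`. -/
noncomputable def solLow (α m g Z : ℝ) : ℝ := (lowC α m Z * betaInt α g) ^ m⁻¹

/-- Upper bound for `y(z) z^(-g)`, `z ≤ Z`. -/
noncomputable def solUpp (α m g Z : ℝ) : ℝ := (uppC α m Z * betaInt α g) ^ m⁻¹

lemma solLow_pos {g : ℝ} (hα0 : 0 < α) (hα1 : α < 1) (hm : 0 < m) (hg : 0 < g) (hZ1 : Z < 1) :
    0 < solLow α m g Z :=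
  Real.rpow_pos_of_pos (mul_pos (lowC_pos hα0 hα1 hm hZ1) (betaInt_pos hα1 (by linarith))) _

lemma solUpp_pos {g : ℝ} (hα0 : 0 < α) (hα1 : α < 1) (hm : 0 < m) (hg : 0 < g) (hZ0 : 0 ≤ Z)
    (hZ1 : Z < 1) : 0 < solUpp α m g Z :=
  Real.rpow_pos_of_pos (mul_pos (uppC_pos hα0 hα1 hm hZ0 hZ1) (betaInt_pos hα1 (by linarith))) _

/-- The factor by which the scheme multiplies the weight `n^(-q)`, `q = g - s`,
when `z_n ≤ Z` and `t = n^(-1-s)`. -/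
noncomputable def amplification (α m g s Z t : ℝ) : ℝ :=
  uppC α m Z * solUpp α m g Z * (betaInt α s + 3 * t) / solLow α m g Z ^ (m + 1)

/-- At `Z = 0` the upper and lower constants coincide, so everything cancels except the two Beta
integrals. -/
lemma amplification_zero {g s : ℝ} (hα0 : 0 < α) (hα1 : α < 1) (hm : 0 < m) (hg : 0 < g) :
    amplification α m g s 0 0 = betaInt α s / betaInt α g := by
  have hc := kernelConst_pos hα0 hα1 hm
  have hJ := betaInt_pos hα1 (show -1 < g by linarith)
  have h1 : lowC α m 0 = kernelConst α m := by simp [lowC]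
  have h2 : uppC α m 0 = kernelConst α m := by simp [uppC]
  have h3 : 0 < (kernelConst α m * betaInt α g) ^ m⁻¹ := by positivity
  rw [amplification, solUpp, solLow, h1, h2, rpow_add_one' h3.le hm,
    ← Real.rpow_mul (by positivity), inv_mul_cancel₀ hm.ne', Real.rpow_one]
  field_simp
  ring

/-- Lets the strict bound by `m+1` at `Z = 0` persist on some interval `[0,Z]` with `Z > 0`. -/
lemma continuousAt_amplification_left {g s : ℝ} (hα0 : 0 < α) (hα1 : α < 1) (hm : 0 < m)
    (hg : 0 < g) : ContinuousAt (fun Z => amplification α m g s Z 0) 0 := by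
  have hJ := betaInt_pos hα1 (show -1 < g by linarith)
  have h1 : ContinuousAt (fun Z => uppC α m Z) 0 := by
    unfold uppC
    refine continuousAt_const.mul ((by fun_prop : ContinuousAt (fun Z : ℝ => 1 + 2 / α * Z) 0).mul
      (ContinuousAt.rpow_const ?_ (Or.inl (by norm_num))))
    exact continuousAt_const.div (by fun_prop) (by norm_num)
  have h2 : ContinuousAt (fun Z => lowC α m Z) 0 := by unfold lowC; fun_prop
  have h3 : ContinuousAt (fun Z => solUpp α m g Z) 0 :=
    (h1.mul continuousAt_const).rpow_const (Or.inr (by positivity))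
  have h4 : ContinuousAt (fun Z => solLow α m g Z) 0 :=
    (h2.mul continuousAt_const).rpow_const (Or.inr (by positivity))
  have hp := solLow_pos hα0 hα1 hm hg (Z := 0) one_pos
  unfold amplification
  exact ((h1.mul h3).mul continuousAt_const).div (h4.rpow_const (Or.inl hp.ne'))
    (by positivity)

lemma amplification_mono {g s t t' : ℝ} (hα0 : 0 < α) (hα1 : α < 1) (hm : 0 < m) (hg : 0 < g)
    (hZ0 : 0 ≤ Z) (hZ1 : Z < 1) (ht : t ≤ t') :
    amplification α m g s Z t ≤ amplification α m g s Z t' := by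
  have h1 := uppC_pos hα0 hα1 hm hZ0 hZ1
  have h2 := solUpp_pos hα0 hα1 hm hg hZ0 hZ1
  have h3 := solLow_pos hα0 hα1 hm hg hZ1
  unfold amplification
  gcongr

end Bounds

/-! ### The scheme applied to the exact solution -/

namespace IsNontrivialSolution

variable {α m g Z : ℝ} {y : ℝ → ℝ}

lemma solLow_mul_le (hy : IsNontrivialSolution α m y) (hα0 : 0 < α) (hα1 : α < 1)
    (hm : 0 < m) (hg0 : 0 < g) (hg : g * m = 2 - α) (hZ1 : Z < 1) {z : ℝ} (hz : 0 ≤ z)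
    (hzZ : z ≤ Z) : solLow α m g Z * z ^ g ≤ y z :=
  hy.lower hα0 hα1 hm hg0 hg (lowC_pos hα0 hα1 hm hZ1) hZ1 (lowC_mul_le hα0 hα1 hm hZ1) hz hzZ

lemma le_solUpp_mul (hy : IsNontrivialSolution α m y) (hα0 : 0 < α) (hα1 : α < 1)
    (hm : 0 < m) (hg0 : 0 < g) (hg : g * m = 2 - α) (hZ1 : Z < 1) {z : ℝ} (hz : 0 ≤ z)
    (hzZ : z ≤ Z) : y z ≤ solUpp α m g Z * z ^ g :=
  hy.upper hα0 hα1 hm hg0 hg (uppC_pos hα0 hα1 hm (hz.trans hzZ) hZ1) hZ1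
    (le_uppC_mul hα0 hα1 hm hZ1) hz hzZ

lemma solLow_rpow_mul_le (hy : IsNontrivialSolution α m y) (hα0 : 0 < α) (hα1 : α < 1)
    (hm : 0 < m) (hg0 : 0 < g) (hg : g * m = 2 - α) (hZ1 : Z < 1) {z : ℝ} (hz : 0 ≤ z)
    (hzZ : z ≤ Z) : solLow α m g Z ^ (m + 1) * z ^ (2 - α + g) ≤ y z ^ (m + 1) := by
  have h1 := solLow_pos hα0 hα1 hm hg0 hZ1
  have h2 : z ^ (2 - α + g) = (z ^ g) ^ (m + 1) := by
    rw [← Real.rpow_mul hz, ← hg]; ring_nf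
  rw [h2, ← Real.mul_rpow h1.le (by positivity)]
  exact Real.rpow_le_rpow (by positivity) (hy.solLow_mul_le hα0 hα1 hm hg0 hg hZ1 hz hzZ)
    (by linarith)

lemma rpow_le_solUpp_mul (hy : IsNontrivialSolution α m y) (hα0 : 0 < α) (hα1 : α < 1)
    (hm : 0 < m) (hg0 : 0 < g) (hg : g * m = 2 - α) (hZ1 : Z < 1) {z : ℝ} (hz : 0 ≤ z)
    (hzZ : z ≤ Z) : y z ^ (m + 1) ≤ solUpp α m g Z ^ (m + 1) * z ^ (2 - α + g) := by
  have h1 := solUpp_pos hα0 hα1 hm hg0 (hz.trans hzZ) hZ1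
  have h2 : z ^ (2 - α + g) = (z ^ g) ^ (m + 1) := by
    rw [← Real.rpow_mul hz, ← hg]; ring_nf
  rw [h2, ← Real.mul_rpow h1.le (by positivity)]
  exact Real.rpow_le_rpow (hy.nonneg z ⟨hz, by linarith⟩)
    (hy.le_solUpp_mul hα0 hα1 hm hg0 hg hZ1 hz hzZ) (by linarith)

/-- Action of the scheme on `y(z_i) i^(-q)`. -/
lemma sum_weight_mul_rpow_le (hy : IsNontrivialSolution α m y) (hα0 : 0 < α) (hα1 : α < 1)
    (hm : 0 < m) (hg0 : 0 < g) (hg : g * m = 2 - α) (hZ1 : Z < 1) {q : ℝ}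
    (hq1 : q < 1) (hgq : g ≤ q) {N n : ℕ} (hN : 1 ≤ N) (hn : 2 ≤ n) (hnZ : node N n ≤ Z) :
    ∑ i ∈ Finset.range n, weight α m N n i * (y (node N i) * (i : ℝ) ^ (-q)) ≤
      amplification α m g (g - q) Z ((n : ℝ) ^ (-(1 + (g - q)))) * (n : ℝ) ^ (-q) *
        y (node N n) ^ (m + 1) := by
  have hst : 0 < step N := by unfold step; positivity
  have hn0 : (0 : ℝ) < n := by exact_mod_cast (by omega : 0 < n)
  have hz0 : 0 < node N n := by rw [node_eq_mul_step]; positivity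
  have hZ0 : 0 ≤ Z := hz0.le.trans hnZ
  have hup := uppC_pos hα0 hα1 hm hZ0 hZ1
  have hsu := solUpp_pos hα0 hα1 hm hg0 hZ0 hZ1
  have hsl := solLow_pos hα0 hα1 hm hg0 hZ1
  have hJ := betaInt_pos hα1 (show -1 < g - q by linarith)
  -- Writing `i^(-q) = h^q z_i^(-q)` turns the sequence into a multiple of `z_i^(g-q)`; `g ≤ q`
  -- makes this power nonincreasing.
  have hmain := sum_weight_mul_le hα0 hα1 hm hup.le
    (show 0 ≤ solUpp α m g Z * step N ^ q by positivity) (show -1 < g - q by linarith)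
    (by linarith) hN hn (by linarith) (fun u h1 h2 => le_uppC_mul hα0 hα1 hm hZ1 u _ h1 h2 hnZ)
    (f := fun i => y (node N i) * (i : ℝ) ^ (-q))
    (by simp [node_zero, hy.apply_zero]) (by
      intro i h1 h2
      have hi0 : (0 : ℝ) < i := by exact_mod_cast h1
      have hzi : 0 < node N i := by rw [node_eq_mul_step]; positivity
      have h3 := hy.le_solUpp_mul hα0 hα1 hm hg0 hg hZ1 hzi.le ((node_mono N h2.le).trans hnZ)
      have h4 : (i : ℝ) ^ (-q) = step N ^ q * node N i ^ (-q) := by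
        rw [node_eq_mul_step, Real.mul_rpow hi0.le hst.le, Real.rpow_neg hst.le]
        field_simp
      calc y (node N i) * (i : ℝ) ^ (-q)
          ≤ (solUpp α m g Z * node N i ^ g) * (i : ℝ) ^ (-q) := by gcongr
        _ = solUpp α m g Z * step N ^ q * (node N i ^ g * node N i ^ (-q)) := by rw [h4]; ring
        _ = _ := by rw [← Real.rpow_add hzi]; rfl)
  refine hmain.trans ?_
  have hlow := hy.solLow_rpow_mul_le hα0 hα1 hm hg0 hg hZ1 hz0.le hnZ
  have h5 : step N ^ q * node N n ^ (2 - α + (g - q)) = (n : ℝ) ^ (-q) * node N n ^ (2 - α + g) := by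
    rw [show 2 - α + (g - q) = -q + (2 - α + g) by ring, Real.rpow_add hz0, ← mul_assoc]
    congr 1
    rw [node_eq_mul_step, Real.mul_rpow hn0.le hst.le, Real.rpow_neg hst.le]
    field_simp
  set t := (n : ℝ) ^ (-(1 + (g - q))) with ht
  have ht0 : 0 < t := by positivity
  have hsp : 0 < solLow α m g Z ^ (m + 1) := by positivity
  calc _ = uppC α m Z * solUpp α m g Z * (betaInt α (g - q) + 3 * t) *
        (step N ^ q * node N n ^ (2 - α + (g - q))) := by ring
    _ = amplification α m g (g - q) Z t * (n : ℝ) ^ (-q) *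
        (solLow α m g Z ^ (m + 1) * node N n ^ (2 - α + g)) := by
        rw [h5, amplification]; field_simp
    _ ≤ _ := by
      refine mul_le_mul_of_nonneg_left hlow ?_
      unfold amplification
      positivity

/-- For either parity the node `n-1` is the last midpoint and carries the coefficient `2`. This
keeps the scheme positive and bounds its sums from below at small `n`. -/
lemma weight_pred_ge (hα0 : 0 < α) (hα1 : α < 1) (hm : 0 < m) (hZ1 : Z < 1) {N n : ℕ}
    (hn : 2 ≤ n) (hnZ : node N n ≤ Z) :
    2 * step N * (lowC α m Z * step N ^ (1 - α)) ≤ weight α m N n (n - 1) := by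
  obtain ⟨i, rfl⟩ : ∃ i, n = i + 1 := ⟨n - 1, by omega⟩
  have h1 := lowC_mul_le hα0 hα1 hm hZ1 (node N i) (node N (i + 1)) (node_nonneg _ _)
    (node_mono N (by omega)) hnZ
  have h2 : coef ((i + 1) % 2) i = 2 := by
    unfold coef
    rw [if_neg (by omega), if_pos (by omega)]
  rw [node_succ, add_sub_cancel_left, ← node_succ] at h1
  have hst := step_nonneg N
  rw [Nat.add_sub_cancel, weight, h2]
  have := mul_le_mul_of_nonneg_left h1 (show 0 ≤ 2 * step N by positivity)
  linarith

lemma weight_nonneg (hα0 : 0 < α) (hα1 : α < 1) (hm : 0 < m) {N n i : ℕ}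
    (hi : i ≤ n) (hn1 : node N n < 1) : 0 ≤ weight α m N n i :=
  mul_nonneg (mul_nonneg (step_nonneg N)
    (kernel_nonneg hα0 hα1 hm (node_nonneg _ _) (node_mono N hi) hn1)) (coef_nonneg _ _)

/-- Consistency of the scheme, with relative error `O(1/n)`. -/
lemma exists_consistency (hy : IsNontrivialSolution α m y) (hα0 : 0 < α) (hα1 : α < 1)
    (hm : 0 < m) (hg0 : 0 < g) (hg : g * m = 2 - α) (hZ0 : 0 ≤ Z) (hZ1 : Z < 1) :
    ∃ C : ℝ, 0 ≤ C ∧ ∀ N n : ℕ, 1 ≤ N → 2 ≤ n → node N n ≤ Z →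
      ∑ i ∈ Finset.range n, weight α m N n i * y (node N i) ≤
        (1 + C / n) * y (node N n) ^ (m + 1) ∧
      y (node N n) ^ (m + 1) ≤
        (1 + C / n) * ∑ i ∈ Finset.range n, weight α m N n i * y (node N i) := by
  have hup := uppC_pos hα0 hα1 hm hZ0 hZ1
  have hlo := lowC_pos hα0 hα1 hm hZ1
  have hsu := solUpp_pos hα0 hα1 hm hg0 hZ0 hZ1
  have hsl := solLow_pos hα0 hα1 hm hg0 hZ1
  have hJ := betaInt_pos hα1 (show -1 < g by linarith)
  -- `Q/n` is the relative quadrature error, informative only once `n ≥ 2Q`. `R` handles the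
  -- remaining `n < 2Q`, where the single term `i = n-1` already dominates `y(z_n)^(m+1)` up to a
  -- constant.
  set Q := 5 * uppC α m Z / solLow α m g Z ^ m with hQ
  set R := solUpp α m g Z ^ (m + 1) * (2 * Q) ^ (2 - α + g) /
    (2 * lowC α m Z * solLow α m g Z) with hR
  have hQ0 : 0 ≤ Q := by positivity
  have hR0 : 0 ≤ R := by positivity
  refine ⟨2 * Q + R * (2 * Q), by positivity, ?_⟩
  intro N n hN hn hnZ
  have hst : 0 < step N := by unfold step; positivity
  have hn0 : (0 : ℝ) < n := by exact_mod_cast (by omega : 0 < n)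
  have hz0 : 0 < node N n := by rw [node_eq_mul_step]; positivity
  have hz1 : node N n < 1 := by linarith
  have hyz := hy.pos _ ⟨hz0, hz1.le⟩
  have hquad := hy.abs_sum_weight_sub_le hα0 hα1 hm hn hz1
  set A := ∑ i ∈ Finset.range n, weight α m N n i * y (node N i) with hA
  set z := node N n with hz
  have herr : 5 * step N * (kernel α m z 0 * y z) ≤ Q / n * y z ^ (m + 1) := by
    have h1 := le_uppC_mul hα0 hα1 hm hZ1 0 z le_rfl hz0.le hnZ
    rw [sub_zero] at h1
    have h2 := hy.solLow_mul_le hα0 hα1 hm hg0 hg hZ1 hz0.le hnZ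
    have h3 : solLow α m g Z ^ m * z ^ (2 - α) ≤ y z ^ m := by
      rw [← hg, Real.rpow_mul hz0.le, ← Real.mul_rpow hsl.le (by positivity)]
      exact Real.rpow_le_rpow (by positivity) h2 hm.le
    have h4 : step N = z / n := by rw [hz, node_eq_mul_step]; field_simp
    have h5 : z * z ^ (1 - α) = z ^ (2 - α) := by
      rw [show 2 - α = 1 + (1 - α) by ring, Real.rpow_add hz0, Real.rpow_one]
    have hslm : 0 < solLow α m g Z ^ m := by positivity
    calc 5 * step N * (kernel α m z 0 * y z)
        ≤ 5 * step N * (uppC α m Z * z ^ (1 - α) * y z) := by gcongr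
      _ = 5 * uppC α m Z / n * (z * z ^ (1 - α)) * y z := by rw [h4]; ring
      _ = Q / n * (solLow α m g Z ^ m * z ^ (2 - α)) * y z := by rw [h5, hQ]; field_simp
      _ ≤ Q / n * y z ^ m * y z := by gcongr
      _ = _ := by rw [rpow_add_one' hyz.le hm]; ring
  have hym : 0 < y z ^ (m + 1) := by positivity
  have hsub : ∀ i, i < n → 0 ≤ weight α m N n i * y (node N i) := fun i hi =>
    mul_nonneg (weight_nonneg hα0 hα1 hm hi.le hz1)
      (hy.nonneg _ ⟨node_nonneg _ _, (node_mono N hi.le).trans hz1.le⟩)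
  have hA0 : 0 ≤ A := Finset.sum_nonneg fun i hi => hsub i (Finset.mem_range.1 hi)
  rw [abs_le] at hquad
  have hQn : 0 ≤ Q / n := by positivity
  have hCn : (2 * Q + R * (2 * Q)) / n = 2 * (Q / n) + R * (2 * Q) / n := by ring
  have hRn : 0 ≤ R * (2 * Q) / n := by positivity
  rw [hCn]
  constructor
  · have := mul_nonneg (add_nonneg hQn hRn) hym.le
    linarith [hquad.2]
  · rcases le_or_gt (2 * Q) n with hbig | hsmall
    · have h1 : Q / n ≤ 1 / 2 := by
        rw [div_le_iff₀ hn0]; linarith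
      have h2 : y z ^ (m + 1) ≤ 2 * A := by nlinarith [hquad.1]
      have h3 := mul_le_mul_of_nonneg_left h2 hQn
      have h4 := mul_nonneg hRn hA0
      linarith [hquad.1]
    · have h1 := weight_pred_ge hα0 hα1 hm hZ1 hn hnZ
      have hsn : step N ≤ node N (n - 1) := by
        rw [← node_one]; exact node_mono N (by omega)
      have hnZ' : node N (n - 1) ≤ Z := (node_mono N (by omega)).trans hnZ
      have h2 := hy.solLow_mul_le hα0 hα1 hm hg0 hg hZ1 (node_nonneg N (n - 1)) hnZ'
      have h3 : solLow α m g Z * step N ^ g ≤ y (node N (n - 1)) :=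
        le_trans (by gcongr) h2
      have h4 : weight α m N n (n - 1) * y (node N (n - 1)) ≤ A :=
        Finset.single_le_sum (f := fun i => weight α m N n i * y (node N i))
          (fun i hi => hsub i (Finset.mem_range.1 hi)) (Finset.mem_range.2 (by omega))
      have h5 : step N * step N ^ (1 - α) * step N ^ g = step N ^ (2 - α + g) := by
        rw [show 2 - α + g = 1 + (1 - α) + g by ring, Real.rpow_add hst, Real.rpow_add hst,
          Real.rpow_one]
      have h6 : 2 * lowC α m Z * solLow α m g Z * step N ^ (2 - α + g) ≤ A := by
        refine le_trans ?_ h4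
        calc _ = 2 * step N * (lowC α m Z * step N ^ (1 - α)) *
              (solLow α m g Z * step N ^ g) := by rw [← h5]; ring
          _ ≤ _ := mul_le_mul h1 h3 (by positivity) (le_trans (by positivity) h1)
      have h7 := hy.rpow_le_solUpp_mul hα0 hα1 hm hg0 hg hZ1 hz0.le hnZ
      have hexp : 0 ≤ 2 - α + g := by linarith
      have h8 : y z ^ (m + 1) ≤ R * A := by
        calc y z ^ (m + 1) ≤ solUpp α m g Z ^ (m + 1) * z ^ (2 - α + g) := h7
          _ = solUpp α m g Z ^ (m + 1) * ((n : ℝ) ^ (2 - α + g) * step N ^ (2 - α + g)) := by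
            rw [← Real.mul_rpow hn0.le hst.le, ← node_eq_mul_step]
          _ ≤ solUpp α m g Z ^ (m + 1) * ((2 * Q) ^ (2 - α + g) * step N ^ (2 - α + g)) := by
            gcongr
          _ = R * (2 * lowC α m Z * solLow α m g Z * step N ^ (2 - α + g)) := by
            rw [hR]; field_simp
          _ ≤ R * A := by gcongr
      have h9 : R ≤ R * (2 * Q) / n := by
        rw [le_div_iff₀ hn0]; gcongr
      have h10 := mul_le_mul_of_nonneg_right h9 hA0
      have h11 := mul_nonneg hQn hA0
      linarith

end IsNontrivialSolution

/-! ### Error estimates for the scheme -/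

open Filter Topology in
/-- Relative error of the scheme. -/
lemma IsNontrivialSolution.exists_abs_sub_le_mul {α m X κ g q : ℝ} {y : ℝ → ℝ}
    (hy : IsNontrivialSolution α m y) (hα0 : 0 < α) (hα1 : α < 1) (hm : 0 < m) (hX0 : 0 ≤ X)
    (hX1 : X < 1) (hκ : 0 < κ) (hg0 : 0 < g) (hg : g = (2 - α) / m) (hq1 : q < 1) (hgq : g ≤ q)
    {Y : ℕ → ℕ → ℝ} (hY : ∀ N : ℕ, 1 ≤ N → IsMidpointApprox α m κ N (Y N)) :
    ∃ M : ℝ, 0 ≤ M ∧ ∀ N n : ℕ, 1 ≤ N → 1 ≤ n → node N n ≤ X →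
      |Y N n - y (node N n)| ≤ M * (n : ℝ) ^ (-q) * y (node N n) := by
  have hgm : g * m = 2 - α := by rw [hg]; field_simp
  have hq0 : 0 < q := by linarith
  have hJ := betaInt_pos hα1 (show -1 < g by linarith)
  have hlo := lowC_pos hα0 hα1 hm hX1
  have hsu := solUpp_pos hα0 hα1 hm hg0 hX0 hX1
  have hsl := solLow_pos hα0 hα1 hm hg0 hX1
  obtain ⟨C, hC0, hC⟩ := hy.exists_consistency hα0 hα1 hm hg0 hgm hX0 hX1
  have hΦ : amplification α m g (g - q) 0 0 < m + 1 := by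
    rw [amplification_zero hα0 hα1 hm hg0, div_lt_iff₀ hJ]
    have h := betaInt_sub_lt hα1 hg0 hq1
    rwa [show (2 - α) / g = m by rw [← hgm]; field_simp, add_comm] at h
  -- `r` is the contraction constant: above the amplification of `n^(-q)` at the origin, below
  -- `m+1`, and above `1 + m/2` to leave room for the constant part of the weight.
  obtain ⟨r, hr1, hr2⟩ := exists_between
    (max_lt hΦ (show 1 + m / 2 < m + 1 by linarith))
  obtain ⟨hrΦ, hrm⟩ := max_lt_iff.1 hr1
  obtain ⟨Z, hZ0, hZ1, hZr⟩ : ∃ Z, 0 < Z ∧ Z < 1 ∧ amplification α m g (g - q) Z 0 < r := by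
    have h1 := (continuousAt_amplification_left (s := g - q) hα0 hα1 hm hg0).eventually_lt
      continuousAt_const hrΦ
    have h2 : ∀ᶠ Z : ℝ in 𝓝[>] 0, amplification α m g (g - q) Z 0 < r := h1.filter_mono inf_le_left
    obtain ⟨Z, h3, h4⟩ := (h2.and (Ioo_mem_nhdsGT one_pos)).exists
    exact ⟨Z, h4.1, h4.2, h3⟩
  set ε := 1 - r / (m + 1) with hε
  have hεr : (1 - ε) * (m + 1) = r := by rw [hε]; field_simp; ring
  have hε0 : 0 < ε := by
    rw [hε, sub_pos, div_lt_one (by linarith)]; exact hr2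
  have hε1 : ε < 1 := by
    have : 0 < r / (m + 1) := div_pos (by linarith) (by linarith)
    linarith
  obtain ⟨n₀, hn₀⟩ : ∃ n₀ : ℕ, ∀ n : ℕ, n₀ ≤ n →
      amplification α m g (g - q) Z ((n : ℝ) ^ (-(1 + (g - q)))) < r ∧
      (2 * C + C ^ 2) / n < ε ∧ C / n < m / 4 ∧ 1 ≤ n := by
    have h1 : Tendsto (fun n : ℕ => amplification α m g (g - q) Z
        ((n : ℝ) ^ (-(1 + (g - q))))) atTop (𝓝 (amplification α m g (g - q) Z 0)) := by
      have hc : Continuous fun t => amplification α m g (g - q) Z t := by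
        unfold amplification; fun_prop
      exact (hc.tendsto 0).comp ((tendsto_rpow_neg_atTop (by linarith)).comp
        tendsto_natCast_atTop_atTop)
    have h2 := tendsto_const_div_atTop_nhds_zero_nat (2 * C + C ^ 2)
    have h3 := tendsto_const_div_atTop_nhds_zero_nat C
    exact eventually_atTop.1 ((h1.eventually_lt_const hZr).and ((h2.eventually_lt_const hε0).and
      ((h3.eventually_lt_const (by positivity)).and (eventually_ge_atTop 1))))
  set Φ := amplification α m g (g - q) X 1 with hΦX
  have hΦ0 : 0 ≤ Φ := by
    have := uppC_pos hα0 hα1 hm hX0 hX1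
    have := betaInt_pos hα1 (show -1 < g - q by linarith)
    rw [hΦX]; unfold amplification; positivity
  -- Makes `Φ Z^(-q) = V m/4`. Beyond `Z` the two parts of the weight then contribute at most `V m/4
  -- + V (1 + m/4) = V (1 + m/2) ≤ V r`, in units of `N^(-q)`.
  set V := 4 * (Φ * Z ^ (-q)) / m with hV
  have hV0 : 0 ≤ V := by positivity
  set T := max (κ / solLow α m g X) (solUpp α m g X / κ) with hT
  obtain ⟨M, hM0, hM⟩ := exists_abs_sub_le (m := m) (C := C) (ε := ε) (T := T) (V := 1 + V) n₀ hm
    hC0 hε0 hε1 (hn₀ n₀ le_rfl).2.2.2 (hn₀ n₀ le_rfl).2.1.le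
    (le_max_of_le_left (by positivity))
  refine ⟨M * (1 + V), by positivity, ?_⟩
  intro N P hN hP hPX
  have hst : 0 < step N := by unfold step; positivity
  have hnX : ∀ n, n ≤ P → node N n ≤ X := fun n hn => (node_mono N hn).trans hPX
  have hNpos : (0 : ℝ) < N := by exact_mod_cast hN
  have hPN : P ≤ N := by
    have h1 : node N P < 1 := by linarith
    rw [node, div_lt_one hNpos] at h1
    exact_mod_cast h1.le
  have hY' := hY N hN
  have hnode0 : ∀ n, 1 ≤ n → 0 < node N n := fun n hn => by
    have : (0 : ℝ) < n := by exact_mod_cast hn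
    rw [node_eq_mul_step]; positivity
  have hW : ∀ n i, 2 ≤ n → n ≤ P → i < n → 0 ≤ weight α m N n i := fun n i _ hnP hi =>
    weight_nonneg hα0 hα1 hm hi.le ((hnX n hnP).trans_lt hX1)
  have hYpos : ∀ n, 1 ≤ n → n ≤ P → 0 < Y N n := by
    intro n hn
    induction n, hn using Nat.le_induction with
    | base =>
      intro _
      rw [hY'.start]; positivity
    | succ n hn ih =>
      intro hnP
      have h1 := hY'.rpow_eq_sum (show 2 ≤ n + 1 by omega) (hnP.trans hPN)
      have h2 := weight_pred_ge hα0 hα1 hm hX1 (show 2 ≤ n + 1 by omega) (hnX _ hnP)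
      have h3 : weight α m N (n + 1) n * Y N n ≤ Y N (n + 1) ^ (m + 1) := by
        rw [h1]
        refine Finset.single_le_sum (f := fun i => weight α m N (n + 1) i * Y N i)
          (fun i hi => ?_) (Finset.mem_range.2 (by omega))
        have hi' := Finset.mem_range.1 hi
        exact mul_nonneg (hW _ i (by omega) hnP hi') (hY'.nonneg i (by omega))
      rw [Nat.add_sub_cancel] at h2
      have h4 : 0 < weight α m N (n + 1) n := lt_of_lt_of_le (by positivity) h2
      have h5 := mul_pos h4 (ih (by omega))
      refine lt_of_le_of_ne (hY'.nonneg _ (by omega)) fun h0 => ?_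
      rw [← h0, Real.zero_rpow (by linarith)] at h3
      linarith
  have hwV : ∀ n : ℕ, 1 ≤ n → (n : ℝ) ^ (-q) ≤ 1 := fun n hn =>
    Real.rpow_le_one_of_one_le_of_nonpos (by exact_mod_cast hn) (by linarith)
  have hNq0 : 0 ≤ (N : ℝ) ^ (-q) := by positivity
  -- The term `V N^(-q)` costs nothing in the end: `n ≤ N` makes it at most `V n^(-q)`.
  have hfinal := hM P (weight α m N) (fun n => (n : ℝ) ^ (-q) + V * (N : ℝ) ^ (-q))
    (fun n => y (node N n)) (Y N) hW (by simp [node_zero, hy.apply_zero]) hY'.zero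
    (fun n h1 h2 => hy.pos _ ⟨hnode0 n h1, by linarith [hnX n h2]⟩) hYpos
    (fun n h1 h2 => (hC N n hN h1 (hnX n h2)).1) (fun n h1 h2 => (hC N n hN h1 (hnX n h2)).2)
    (fun n h1 h2 => hY'.rpow_eq_sum h1 (h2.trans hPN)) ?_ ?_ ?_ ?_ ?_ P hP le_rfl
  · have h1 : (N : ℝ) ^ (-q) ≤ (P : ℝ) ^ (-q) :=
      Real.rpow_le_rpow_of_nonpos (by exact_mod_cast hP) (by exact_mod_cast hPN) (by linarith)
    have hyP : 0 ≤ y (node N P) := hy.nonneg _ ⟨node_nonneg _ _, by linarith⟩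
    refine hfinal.trans (mul_le_mul_of_nonneg_right ?_ hyP)
    rw [mul_assoc]
    refine mul_le_mul_of_nonneg_left ?_ hM0
    nlinarith
  · intro n hn hn2 hnP
    obtain ⟨ha1, -, ha3, ha4⟩ := hn₀ n hn
    have hn0 : (0 : ℝ) < n := by exact_mod_cast ha4
    have hyn : 0 < y (node N n) := hy.pos _ ⟨hnode0 n ha4, by linarith [hnX n hnP]⟩
    have hym : 0 < y (node N n) ^ (m + 1) := by positivity
    have hsplit : ∑ i ∈ Finset.range n, weight α m N n i *
        (y (node N i) * ((i : ℝ) ^ (-q) + V * (N : ℝ) ^ (-q))) =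
        ∑ i ∈ Finset.range n, weight α m N n i * (y (node N i) * (i : ℝ) ^ (-q)) +
        V * (N : ℝ) ^ (-q) * ∑ i ∈ Finset.range n, weight α m N n i * y (node N i) := by
      rw [Finset.mul_sum, ← Finset.sum_add_distrib]
      exact Finset.sum_congr rfl fun i _ => by ring
    have hmass : V * (N : ℝ) ^ (-q) * ∑ i ∈ Finset.range n, weight α m N n i * y (node N i) ≤
        V * (N : ℝ) ^ (-q) * ((1 + m / 4) * y (node N n) ^ (m + 1)) := by
      refine mul_le_mul_of_nonneg_left ((hC N n hN hn2 (hnX n hnP)).1.trans ?_) (by positivity)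
      gcongr
    rw [hsplit, hεr]
    rcases le_or_gt (node N n) Z with hnZ | hnZ
    · have h1 := hy.sum_weight_mul_rpow_le hα0 hα1 hm hg0 hgm hZ1 hq1 hgq hN hn2 hnZ
      have h2 : amplification α m g (g - q) Z ((n : ℝ) ^ (-(1 + (g - q)))) * (n : ℝ) ^ (-q) *
          y (node N n) ^ (m + 1) ≤ r * (n : ℝ) ^ (-q) * y (node N n) ^ (m + 1) := by gcongr
      have h3 : V * (N : ℝ) ^ (-q) * ((1 + m / 4) * y (node N n) ^ (m + 1)) ≤
          V * (N : ℝ) ^ (-q) * (r * y (node N n) ^ (m + 1)) := by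
        gcongr
        linarith
      linarith
    · have h1 := hy.sum_weight_mul_rpow_le hα0 hα1 hm hg0 hgm hX1 hq1 hgq hN hn2 (hnX n hnP)
      have h2 : amplification α m g (g - q) X ((n : ℝ) ^ (-(1 + (g - q)))) ≤ Φ :=
        amplification_mono hα0 hα1 hm hg0 hX0 hX1
          (Real.rpow_le_one_of_one_le_of_nonpos (by exact_mod_cast ha4) (by linarith))
      have h3 : (n : ℝ) ^ (-q) ≤ Z ^ (-q) * (N : ℝ) ^ (-q) := by
        rw [← Real.mul_rpow hZ0.le hNpos.le]
        rw [node, lt_div_iff₀ hNpos] at hnZ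
        exact Real.rpow_le_rpow_of_nonpos (by positivity) hnZ.le (by linarith)
      have h4 : amplification α m g (g - q) X ((n : ℝ) ^ (-(1 + (g - q)))) * (n : ℝ) ^ (-q) *
          y (node N n) ^ (m + 1) ≤
          Φ * (Z ^ (-q) * (N : ℝ) ^ (-q)) * y (node N n) ^ (m + 1) := by gcongr
      have h5 : Φ * Z ^ (-q) = V * (m / 4) := by rw [hV]; field_simp
      have h6 : 0 ≤ (r - (1 + m / 2)) * (V * (N : ℝ) ^ (-q) * y (node N n) ^ (m + 1)) :=
        mul_nonneg (by linarith) (by positivity)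
      have h7 : 0 ≤ r * (n : ℝ) ^ (-q) * y (node N n) ^ (m + 1) := by
        have : 0 < r := by linarith
        positivity
      have h8 : Φ * (Z ^ (-q) * (N : ℝ) ^ (-q)) * y (node N n) ^ (m + 1) =
          V * (m / 4) * (N : ℝ) ^ (-q) * y (node N n) ^ (m + 1) := by rw [← h5]; ring
      rw [h8] at h4
      linarith
  · intro n hn
    have h1 : (1 : ℝ) / n ≤ (n : ℝ) ^ (-q) := by
      rw [one_div, ← Real.rpow_neg_one]
      exact Real.rpow_le_rpow_of_exponent_le (by exact_mod_cast hn) (by linarith)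
    have : 0 ≤ V * (N : ℝ) ^ (-q) := by positivity
    linarith
  · intro n hn
    have := mul_le_mul_of_nonneg_left (hwV N hN) hV0
    linarith [hwV n hn]
  · have h1 := hy.solLow_mul_le hα0 hα1 hm hg0 hgm hX1 (node_nonneg N 1) (hnX 1 hP)
    rw [node_one] at h1 ⊢
    rw [hY'.start, ← hg]
    have h2 : 0 ≤ y (step N) := le_trans (by positivity) h1
    calc κ * step N ^ g = κ / solLow α m g X * (solLow α m g X * step N ^ g) := by field_simp
      _ ≤ κ / solLow α m g X * y (step N) := by gcongr
      _ ≤ T * y (step N) := by gcongr; exact le_max_left _ _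
  · have h1 := hy.le_solUpp_mul hα0 hα1 hm hg0 hgm hX1 (node_nonneg N 1) (hnX 1 hP)
    rw [node_one] at h1 ⊢
    rw [hY'.start, ← hg]
    calc y (step N) ≤ solUpp α m g X * step N ^ g := h1
      _ = solUpp α m g X / κ * (κ * step N ^ g) := by field_simp
      _ ≤ T * (κ * step N ^ g) := by gcongr; exact le_max_right _ _

/-- Absolute error of the scheme, in a form which interpolates between the behaviour at the first
nodes and away from the origin. -/
lemma IsNontrivialSolution.exists_abs_sub_le_mul_rpow {α m X κ g q : ℝ} {y : ℝ → ℝ}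
    (hy : IsNontrivialSolution α m y) (hα0 : 0 < α) (hα1 : α < 1) (hm : 0 < m) (hX0 : 0 ≤ X)
    (hX1 : X < 1) (hκ : 0 < κ) (hg0 : 0 < g) (hg : g = (2 - α) / m) (hq1 : q < 1) (hgq : g ≤ q)
    {Y : ℕ → ℕ → ℝ} (hY : ∀ N : ℕ, 1 ≤ N → IsMidpointApprox α m κ N (Y N)) :
    ∃ M : ℝ, 0 ≤ M ∧ ∀ N n : ℕ, 1 ≤ N → 1 ≤ n → node N n ≤ X →
      |Y N n - y (node N n)| ≤ M * (step N ^ q * node N n ^ (g - q)) := by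
  have hgm : g * m = 2 - α := by rw [hg]; field_simp
  have hsu := solUpp_pos hα0 hα1 hm hg0 hX0 hX1
  obtain ⟨M, hM0, hM⟩ := hy.exists_abs_sub_le_mul hα0 hα1 hm hX0 hX1 hκ hg0 hg hq1 hgq hY
  refine ⟨M * solUpp α m g X, by positivity, ?_⟩
  intro N n hN hn hnX
  have hst : 0 < step N := by unfold step; positivity
  have hn0 : (0 : ℝ) < n := by exact_mod_cast hn
  have hz0 : 0 < node N n := by rw [node_eq_mul_step]; positivity
  have h1 := hy.le_solUpp_mul hα0 hα1 hm hg0 hgm hX1 hz0.le hnX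
  have h2 : (n : ℝ) ^ (-q) * node N n ^ g = step N ^ q * node N n ^ (g - q) := by
    rw [sub_eq_add_neg, Real.rpow_add hz0, mul_comm (node N n ^ g), ← mul_assoc]
    congr 1
    rw [node_eq_mul_step, Real.mul_rpow hn0.le hst.le, Real.rpow_neg hst.le]
    field_simp
  calc |Y N n - y (node N n)| ≤ M * (n : ℝ) ^ (-q) * y (node N n) := hM N n hN hn hnX
    _ ≤ M * (n : ℝ) ^ (-q) * (solUpp α m g X * node N n ^ g) := by gcongr
    _ = M * solUpp α m g X * ((n : ℝ) ^ (-q) * node N n ^ g) := by ring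
    _ = _ := by rw [h2]

end PorousMedium

/-! ### Convergence and its order -/

theorem mainTheorem2 (α m X κ : ℝ) (hα0 : 0 < α) (hα1 : α < 1) (hX0 : 0 ≤ X) (hX1 : X < 1)
    (hκ : 0 < κ) (hm : 2 - α < m)
    (hA : PorousMedium.constA α m X < α + (2 - α) / m)
    (y : ℝ → ℝ) (hy : PorousMedium.IsNontrivialSolution α m y)
    (Y : ℕ → ℕ → ℝ) (hY : ∀ N : ℕ, 1 ≤ N → PorousMedium.IsMidpointApprox α m κ N (Y N)) :
    -- the order is positive
    0 < PorousMedium.order α m X ∧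
    -- convergence, uniformly on `[0,X]`
    (∀ η : ℝ, 0 < η → ∃ N₀ : ℕ, ∀ N : ℕ, N₀ ≤ N → 1 ≤ N → ∀ n : ℕ,
      PorousMedium.node N n ≤ X → |Y N n - y (PorousMedium.node N n)| < η) ∧
    -- the order of convergence, with a constant uniform for `z_n` in compact subsets of `(0,X]`
    (∀ ε : ℝ, 0 < ε → ∃ C : ℝ, ∀ N : ℕ, 1 ≤ N → ∀ n : ℕ,
      ε ≤ PorousMedium.node N n → PorousMedium.node N n ≤ X →
        |Y N n - y (PorousMedium.node N n)| ≤
          C * PorousMedium.step N ^ PorousMedium.order α m X) ∧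
    -- uniformly on all of `[0,X]` when the order does not exceed that of the starting value
    (PorousMedium.order α m X ≤ (2 - α) / m → ∃ C : ℝ, ∀ N : ℕ, 1 ≤ N → ∀ n : ℕ,
      PorousMedium.node N n ≤ X →
        |Y N n - y (PorousMedium.node N n)| ≤
          C * PorousMedium.step N ^ PorousMedium.order α m X) := by
  have hm0 : 0 < m := by linarith
  set ω := PorousMedium.order α m X with hω
  set g := (2 - α) / m with hg
  have hg0 : 0 < g := div_pos (by linarith) hm0
  have hg1 : g < 1 := (div_lt_one hm0).2 hm
  have hω1 : ω < 1 := PorousMedium.order_lt_one hα0 hα1 hm hX0 hX1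
  have hω0 : 0 < ω := by
    have h : ω = α + (2 - α) / m - PorousMedium.constA α m X := by
      rw [hω, PorousMedium.order]; ring
    linarith
  obtain ⟨M, hM0, hM⟩ := hy.exists_abs_sub_le_mul_rpow hα0 hα1 hm0 hX0 hX1 hκ hg0 hg
    (max_lt hω1 hg1) (le_max_right ω g) hY
  set q := max ω g with hq
  have hst : ∀ N : ℕ, 1 ≤ N → 0 < PorousMedium.step N ∧ PorousMedium.step N ≤ 1 := by
    intro N hN
    have h1 : (1 : ℝ) ≤ N := by exact_mod_cast hN
    exact ⟨by unfold PorousMedium.step; positivity,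
      (div_le_one (by linarith)).2 h1⟩
  -- As `z_n ≥ h` and `g - q ≤ 0`, the factor `z_n^(g-q)` is at most `h^(g-q)`: the worst case is
  -- the first node, with the order of the starting value.
  have hunif : ∀ N : ℕ, 1 ≤ N → ∀ n : ℕ, PorousMedium.node N n ≤ X →
      |Y N n - y (PorousMedium.node N n)| ≤ M * PorousMedium.step N ^ g := by
    intro N hN n hn
    obtain ⟨hs0, hs1⟩ := hst N hN
    rcases Nat.eq_zero_or_pos n with rfl | hn0
    · rw [(hY N hN).zero, PorousMedium.node_zero, hy.apply_zero, sub_zero, abs_zero]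
      positivity
    · refine (hM N n hN hn0 hn).trans (mul_le_mul_of_nonneg_left ?_ hM0)
      have h1 : PorousMedium.step N ≤ PorousMedium.node N n := by
        rw [← PorousMedium.node_one]; exact PorousMedium.node_mono N hn0
      have h2 : PorousMedium.node N n ^ (g - q) ≤ PorousMedium.step N ^ (g - q) :=
        Real.rpow_le_rpow_of_nonpos hs0 h1 (by linarith [le_max_right ω g])
      calc _ ≤ PorousMedium.step N ^ q * PorousMedium.step N ^ (g - q) := by gcongr
        _ = PorousMedium.step N ^ g := by
          rw [← Real.rpow_add hs0]; congr 1; ring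
  refine ⟨hω0, ?_, ?_, ?_⟩
  · intro η hη
    have hlim : Filter.Tendsto (fun N : ℕ => M * PorousMedium.step N ^ g) Filter.atTop
        (nhds (M * 0 ^ g)) :=
      ((tendsto_const_div_atTop_nhds_zero_nat (1 : ℝ)).rpow_const (Or.inr hg0.le)).const_mul M
    rw [Real.zero_rpow hg0.ne', mul_zero] at hlim
    obtain ⟨N₀, hN₀⟩ := Filter.eventually_atTop.1 (hlim.eventually_lt_const hη)
    exact ⟨N₀, fun N hN hN1 n hn => (hunif N hN1 n hn).trans_lt (hN₀ N hN)⟩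
  · intro ε hε
    refine ⟨M * ε ^ (g - q), fun N hN n hεn hn => ?_⟩
    obtain ⟨hs0, hs1⟩ := hst N hN
    have hn0 : 1 ≤ n := by
      rcases Nat.eq_zero_or_pos n with rfl | h
      · rw [PorousMedium.node_zero] at hεn; linarith
      · exact h
    have h1 : PorousMedium.node N n ^ (g - q) ≤ ε ^ (g - q) :=
      Real.rpow_le_rpow_of_nonpos hε hεn (by linarith [le_max_right ω g])
    have h2 : PorousMedium.step N ^ q ≤ PorousMedium.step N ^ ω :=
      Real.rpow_le_rpow_of_exponent_ge hs0 hs1 (le_max_left ω g)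
    calc _ ≤ M * (PorousMedium.step N ^ q * PorousMedium.node N n ^ (g - q)) := hM N n hN hn0 hn
      _ ≤ M * (PorousMedium.step N ^ ω * ε ^ (g - q)) := by
        have h3 := Real.rpow_nonneg (PorousMedium.node_nonneg N n) (g - q)
        gcongr
      _ = _ := by ring
  · intro hωg
    refine ⟨M, fun N hN n hn => (hunif N hN n hn).trans ?_⟩
    obtain ⟨hs0, hs1⟩ := hst N hN
    exact mul_le_mul_of_nonneg_left (Real.rpow_le_rpow_of_exponent_ge hs0 hs1 hωg) hM0
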